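/- Let $(\mathcal X,\rho)$ be a metric space whose topology is Polish, with its Borel $\sigma$-algebra. For probability measures $\nu_1,\nu_2$ on $\mathcal X$ put $$\mathcal T_2(\nu_1,\nu_2)=\inf_{\pi}\int\rho(x,y)^2\,d\pi(x,y)\in[0,\infty],\qquad W_2(\nu_1,\nu_2)=\mathcal T_2(\nu_1,\nu_2)^{1/2},$$ where $\pi$ runs over the couplings of $\nu_1$ and $\nu_2$; let $\mathrm P_2(\mathcal X)$ be the set of probability measures with finite second moment. For $f:\mathcal X\to\mathbf R$ put $|\nabla f|(x)=\limsup_{y\to x,\,y\ne x}\frac{|f(x)-f(y)|}{\rho(x,y)}$, and $|\nabla f|(x)=0$ if $x$ is isolated. For $f:\mathcal X^n\to\mathbf R$ let $|\nabla_i f|(x)$ be the length, at $x^i$, of the gradient of $f$ as a function of its $i$-th coordinate alone, the others being fixed. For $C>0$, a probability measure $\mu$ on $\mathcal X$ satisfies * $\mathbf{LSI}(C)$ if $\operatorname{Ent}_\mu(f^2)\le C\int|\nabla f|^2\,d\mu$ for all locally Lipschitz $f:\mathcal X\to\mathbf R$ for which $f^2$ and $f^2\log f^2$ are $\mu$-integrable,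 where $\operatorname{Ent}_\mu(g)=\int g\log g\,d\mu-\int g\,d\mu\,\log\int g\,d\mu$; * $\mathbf T_2(C)$ if $\mathcal T_2(\nu,\mu)\le C\operatorname H(\nu\,|\,\mu)$ for all probability measures $\nu$ on $\mathcal X$, where $\operatorname H(\nu\,|\,\mu)=\int\log\frac{d\nu}{d\mu}\,d\nu$ if $\nu\ll\mu$ and $+\infty$ otherwise. For $n\ge1$ and $x\in\mathcal X^n$ let $L_n^x=\frac1n\sum_{i=1}^n\delta_{x^i}$ and $F_n(x)=W_2(L_n^x,\mu)$ (with the convention $F_n(x)=0$ if this distance is infinite, which does not happen when $\mu\in\mathrm P_2(\mathcal X)$, in particular not when $\mu$ satisfies some $\mathbf{LSI}(C)$). Consider the condition $$\sum_{i=1}^n|\nabla_iF_n|^2(x)\le\frac1n\quad\text{for }\mu^n\text{-almost every }x\in\mathcal X^n,\text{ for every }n\ge1.\tag{$*$}$$ 1. Let $\mu$ be a probability measure on $\mathcal X$ satisfying $(*)$. For every $C>0$, if $\mu$ satisfies $\mathbf{LSI}(C)$, then $\mu$ satisfies $\mathbf T_2(C)$. 2. Let $\mathcal X=\mathbf R^d$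 with the Euclidean distance, and let $\mu$ be a probability measure that is absolutely continuous with respect to Lebesgue measure. If $\mu\in\mathrm P_2(\mathcal X)$, then $\mu$ satisfies $(*)$. For every $C>0$, if $\mu$ satisfies $\mathbf{LSI}(C)$, then $\mu$ satisfies $\mathbf T_2(C)$ (Otto--Villani). 3. The conclusions of 2 also hold when $\mathcal X=M$ is a connected, second countable, smooth, finite-dimensional Riemannian manifold without boundary, equipped with its Riemannian distance, and $\mu$ is a probability measure on $M$ that gives mass zero to every Borel set whose image in each chart is Lebesgue-null (that is, $\mu$ is absolutely continuous with respect to the Riemannian volume). -/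

import Mathlib

open MeasureTheory Filter Topology InformationTheory
open scoped ENNReal Manifold ContDiff Bundle

noncomputable section

namespace OttoVillani

section Transport

variable {X : Type*} [MetricSpace X] [MeasurableSpace X]

/-- The optimal quadratic transportation cost: the infimum of `∫ ρ(x,y)² dγ` over all couplings `γ`
of `ν₁` and `ν₂`. -/
def transportCost (ν₁ ν₂ : Measure X) : ℝ≥0∞ :=
  ⨅ (γ : Measure (X × X)) (_ : γ.fst = ν₁ ∧ γ.snd = ν₂), ∫⁻ p, edist p.1 p.2 ^ 2 ∂γ

/-- The quadratic Wasserstein distance (finite on measures with finite second moment). -/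
def wasserstein (ν₁ ν₂ : Measure X) : ℝ≥0∞ :=
  transportCost ν₁ ν₂ ^ (1 / 2 : ℝ)

/-- Finiteness of the second moment, i.e. membership in `P₂(X)` for a probability measure. -/
def HasFiniteSecondMoment (μ : Measure X) : Prop :=
  ∃ x₀ : X, ∫⁻ x, edist x₀ x ^ 2 ∂μ < ⊤

/-- The empirical measure of the points `x 0, …, x (n - 1)`. -/
def empiricalMeasure {n : ℕ} (x : Fin n → X) : Measure X :=
  (n : ℝ≥0∞)⁻¹ • ∑ i, Measure.dirac (x i)

/-- The function `F_n(x) = W₂(L_n^x, μ)` on `X^n`. -/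
def empiricalDist (μ : Measure X) (n : ℕ) (x : Fin n → X) : ℝ :=
  (wasserstein (empiricalMeasure x) μ).toReal

/-- The transportation-cost inequality `T₂(C)`: the cost is at most `C` times the relative entropy,
for every probability measure `ν`. -/
def TalagrandT2 (μ : Measure X) (C : ℝ) : Prop :=
  ∀ ν : Measure X, IsProbabilityMeasure ν →
    transportCost ν μ ≤ ENNReal.ofReal C * klDiv ν μ

end Transport

section Gradient

variable {X : Type*} [MetricSpace X]

/-- The length of the gradient, `limsup_{y → x, y ≠ x} |f x - f y| / ρ(x,y)`. At an isolated point
the punctured neighbourhood filter is `⊥`, and the value is `0`. -/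
def gradLength (f : X → ℝ) (x : X) : ℝ≥0∞ :=
  limsup (fun y => edist (f x) (f y) / edist x y) (𝓝[≠] x)

/-- The length of the `i`-th partial derivative of a function on `X^n`. -/
def partialGradLength {n : ℕ} (f : (Fin n → X) → ℝ) (i : Fin n) (x : Fin n → X) : ℝ≥0∞ :=
  gradLength (fun z => f (Function.update x i z)) (x i)

variable [MeasurableSpace X]

/-- `∑ i, |∇_i F_n|² ≤ 1/n` holds `μ^n`-almost everywhere, for every `n ≥ 1`. -/
def GradientCondition (μ : Measure X) : Prop :=
  ∀ n : ℕ, 0 < n → ∀ᵐ x ∂(Measure.pi fun _ : Fin n => μ),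
    ∑ i, partialGradLength (empiricalDist μ n) i x ^ 2 ≤ (n : ℝ≥0∞)⁻¹

/-- The entropy functional `∫ g log g dμ - ∫ g dμ log (∫ g dμ)`. -/
def ent (μ : Measure X) (g : X → ℝ) : ℝ :=
  ∫ x, g x * Real.log (g x) ∂μ - (∫ x, g x ∂μ) * Real.log (∫ x, g x ∂μ)

/-- The logarithmic Sobolev inequality `LSI(C)`: it is required for all locally Lipschitz `f` such
that the integrals in the entropy of `f²` exist and are finite. -/
def LogSobolev (μ : Measure X) (C : ℝ) : Prop :=
  ∀ f : X → ℝ, LocallyLipschitz f →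
    Integrable (fun x => f x ^ 2) μ →
    Integrable (fun x => f x ^ 2 * Real.log (f x ^ 2)) μ →
    ENNReal.ofReal (ent μ fun x => f x ^ 2) ≤ ENNReal.ofReal C * ∫⁻ x, gradLength f x ^ 2 ∂μ

end Gradient

/-- Absolute continuity with respect to the Lebesgue measure class of a `d`-dimensional manifold:
a Borel set whose image in every chart is Lebesgue-null has measure zero. For a smooth atlas these
are exactly the Borel null sets of the Riemannian volume of any Riemannian metric. -/
def ManifoldAbsolutelyContinuous (d : ℕ) {M : Type*} [TopologicalSpace M] [MeasurableSpace M]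
    [ChartedSpace (EuclideanSpace ℝ (Fin d)) M] (μ : Measure M) : Prop :=
  ∀ s : Set M, MeasurableSet s →
    (∀ e ∈ atlas (EuclideanSpace ℝ (Fin d)) M, volume (e '' (s ∩ e.source)) = 0) → μ s = 0

end OttoVillani

end

namespace OttoVillani

open scoped ProbabilityTheory

/-! The proof of part 1 plays two limits of `F_n = W₂(L_n, μ)` against each other. By the triangle
inequality for `W₂`, `F_n` is Lipschitz with constant `n^{-1/2}` for the `ℓ²` product distance, and
`(∗)` turns this into a bound on its gradient. Since entropy is subadditive over products
(`ofReal_ent_pi_le`), `LSI(C)` passes to `μⁿ`, and Herbst's argument (`cgf_le_of_ent_exp_le`) gives,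
for a bounded truncation `G` of `F_n`, `log ∫ exp(n l G) dμⁿ ≤ n (l ∫ G dμⁿ + C l² / 4)`.

On the other side, the entropy duality `∫ f dQ ≤ H(Q|P) + log ∫ exp f dP` with `Q = νⁿ`, `P = μⁿ`,
together with `H(νⁿ|μⁿ) ≤ n H(ν|μ)`, shows after division by `n` that `l ∫ G dνⁿ ≤ H(ν|μ) + l ∫ G
dμⁿ + C l² / 4`. The empirical measures converge in mean `W₂` distance to the sampled law. Under
`μⁿ` this makes `G` negligible; under `νⁿ` it pushes `G` up to `w = W₂(ν, μ)`. Hence `l w ≤ H + C l²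
/ 4` for every `l > 0`, and optimising in `l` gives `w² ≤ C H`. Convergence in mean replaces any
large deviation principle. It requires second moments: `LSI(C)` gives `μ` a Gaussian moment, and
finite entropy transfers the second moment to `ν`.

For parts 2 and 3 it remains to check `(∗)`. Read in charts, `F_n` is locally Lipschitz, so by
Rademacher it is differentiable almost everywhere, jointly in all coordinates. At such a point let
`L_i` be the partial differentials in charts that are isometric to first order. Moving along the
gradient changes `F_n` at rate `∑ ‖L_i‖²`, while the Lipschitz bound allows at most `(n⁻¹ ∑
‖L_i‖²)^{1/2}`; therefore `∑ ‖L_i‖² ≤ 1/n`. The Euclidean case is the manifold case with a single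
chart. -/

/-- Two couplings with a common marginal can be glued together. -/
theorem exists_gluing {X : Type*} [MeasurableSpace X] [StandardBorelSpace X]
    (γ₁ γ₂ : Measure (X × X)) [IsFiniteMeasure γ₁] [IsFiniteMeasure γ₂] (h : γ₁.snd = γ₂.fst) :
    ∃ Θ : Measure (X × (X × X)), Θ.map (fun q => (q.2.1, q.1)) = γ₁ ∧
      Θ.map (fun q => (q.1, q.2.2)) = γ₂ := by
  rcases isEmpty_or_nonempty X with hX | hX
  · exact ⟨0, Subsingleton.elim _ _, Subsingleton.elim _ _⟩
  set γ₀ := γ₁.map Prod.swap with hγ₀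
  have h0 : γ₀.fst = γ₂.fst := by rw [hγ₀, Measure.fst_map_swap, h]
  have e0 : γ₂.fst ⊗ₘ γ₀.condKernel = γ₀ := by rw [← h0]; exact γ₀.disintegrate _
  have e2 : γ₂.fst ⊗ₘ γ₂.condKernel = γ₂ := γ₂.disintegrate _
  -- The first coordinate carries the shared marginal; given it, the two outer points are drawn
  -- independently from the disintegrations.
  refine ⟨γ₂.fst ⊗ₘ (γ₀.condKernel ×ₖ γ₂.condKernel), ?_, ?_⟩
  · have hs : γ₁ = γ₀.map Prod.swap := by
      rw [hγ₀, Measure.map_map measurable_swap measurable_swap]; simp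
    refine Eq.trans ?_ hs.symm
    refine Measure.ext_of_lintegral _ fun f hf => ?_
    conv_rhs => rw [← e0]
    rw [lintegral_map hf (by fun_prop), lintegral_map hf (by fun_prop),
      Measure.lintegral_compProd (by fun_prop), Measure.lintegral_compProd (by fun_prop)]
    refine lintegral_congr fun a => ?_
    rw [ProbabilityTheory.Kernel.lintegral_prod _ _ _ (by fun_prop)]
    simp
  · refine Measure.ext_of_lintegral _ fun f hf => ?_
    conv_rhs => rw [← e2]
    rw [lintegral_map hf (by fun_prop),
      Measure.lintegral_compProd (by fun_prop), Measure.lintegral_compProd (by fun_prop)]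
    refine lintegral_congr fun a => ?_
    rw [ProbabilityTheory.Kernel.lintegral_prod _ _ _ (by fun_prop)]
    simp

/-! ### Couplings and the triangle inequality for `W₂`. -/

section Couplings

variable {X : Type*} [MetricSpace X] [MeasurableSpace X]

theorem transportCost_le {ν₁ ν₂ : Measure X} (γ : Measure (X × X)) (h₁ : γ.fst = ν₁)
    (h₂ : γ.snd = ν₂) : transportCost ν₁ ν₂ ≤ ∫⁻ p, edist p.1 p.2 ^ 2 ∂γ :=
  iInf₂_le γ ⟨h₁, h₂⟩

theorem wasserstein_sq (ν₁ ν₂ : Measure X) :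
    wasserstein ν₁ ν₂ ^ 2 = transportCost ν₁ ν₂ := by
  rw [wasserstein, ← ENNReal.rpow_natCast, ← ENNReal.rpow_mul]
  norm_num

/-- The square root is an order isomorphism of `[0, ∞]`, so it commutes with the infimum.
Inequalities for `W₂` can then be checked coupling by coupling, without optimal couplings. -/
theorem wasserstein_eq_iInf (ν₁ ν₂ : Measure X) :
    wasserstein ν₁ ν₂ = ⨅ (γ : Measure (X × X)) (_ : γ.fst = ν₁ ∧ γ.snd = ν₂),
      (∫⁻ p, edist p.1 p.2 ^ 2 ∂γ) ^ (1 / 2 : ℝ) := by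
  have := (ENNReal.orderIsoRpow (1 / 2) (by norm_num)).map_iInf₂
    (fun (γ : Measure (X × X)) (_ : γ.fst = ν₁ ∧ γ.snd = ν₂) => ∫⁻ p, edist p.1 p.2 ^ 2 ∂γ)
  exact this

variable [BorelSpace X] [SecondCountableTopology X]

theorem measurable_edist_sq : Measurable fun p : X × X => edist p.1 p.2 ^ 2 := by
  fun_prop

theorem transportCost_comm (ν₁ ν₂ : Measure X) : transportCost ν₁ ν₂ = transportCost ν₂ ν₁ := by
  suffices h : ∀ ν₁ ν₂ : Measure X, transportCost ν₁ ν₂ ≤ transportCost ν₂ ν₁ from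
    le_antisymm (h _ _) (h _ _)
  intro ν₁ ν₂
  refine le_iInf₂ fun γ hγ => ?_
  refine (transportCost_le (γ.map Prod.swap) (by rw [Measure.fst_map_swap, hγ.2])
    (by rw [Measure.snd_map_swap, hγ.1])).trans_eq ?_
  rw [lintegral_map measurable_edist_sq measurable_swap]
  simp [edist_comm]

theorem wasserstein_comm (ν₁ ν₂ : Measure X) : wasserstein ν₁ ν₂ = wasserstein ν₂ ν₁ := by
  rw [wasserstein, transportCost_comm, wasserstein]

/-- Glue two arbitrary couplings along `ν₂` and apply Minkowski in `L²` of the glued measure; its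
outer marginals form a coupling of `ν₁` and `ν₃`. -/
theorem wasserstein_triangle [StandardBorelSpace X] (ν₁ ν₂ ν₃ : Measure X) [IsFiniteMeasure ν₁]
    [IsFiniteMeasure ν₂] : wasserstein ν₁ ν₃ ≤ wasserstein ν₁ ν₂ + wasserstein ν₂ ν₃ := by
  rw [wasserstein_eq_iInf ν₁ ν₂, wasserstein_eq_iInf ν₂ ν₃]
  simp only [ENNReal.iInf_add, ENNReal.add_iInf]
  refine le_iInf₂ fun γ₂ h₂ => le_iInf₂ fun γ₁ h₁ => ?_
  have f₁ : IsFiniteMeasure γ₁ := ⟨by rw [← Measure.fst_univ, h₁.1]; exact measure_lt_top _ _⟩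
  have f₂ : IsFiniteMeasure γ₂ := ⟨by rw [← Measure.fst_univ, h₂.1]; exact measure_lt_top _ _⟩
  obtain ⟨Θ, e₁, e₂⟩ := exists_gluing γ₁ γ₂ (h₁.2.trans h₂.1.symm)
  have key : transportCost ν₁ ν₃ ≤ ∫⁻ q, edist q.2.1 q.2.2 ^ 2 ∂Θ := by
    refine (transportCost_le (Θ.map Prod.snd) ?_ ?_).trans_eq ?_
    · rw [← h₁.1, ← e₁, Measure.fst, Measure.fst, Measure.map_map (by fun_prop) (by fun_prop),
        Measure.map_map (by fun_prop) (by fun_prop)]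
      rfl
    · rw [← h₂.2, ← e₂, Measure.snd, Measure.snd, Measure.map_map (by fun_prop) (by fun_prop),
        Measure.map_map (by fun_prop) (by fun_prop)]
      rfl
    · rw [lintegral_map measurable_edist_sq measurable_snd]
  have i₁ : ∫⁻ p, edist p.1 p.2 ^ 2 ∂γ₁ = ∫⁻ q, edist q.2.1 q.1 ^ 2 ∂Θ := by
    rw [← e₁, lintegral_map measurable_edist_sq (by fun_prop)]
  have i₂ : ∫⁻ p, edist p.1 p.2 ^ 2 ∂γ₂ = ∫⁻ q, edist q.1 q.2.2 ^ 2 ∂Θ := by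
    rw [← e₂, lintegral_map measurable_edist_sq (by fun_prop)]
  have mink := ENNReal.lintegral_Lp_add_le (μ := Θ) (p := 2)
    (f := fun q : X × (X × X) => edist q.2.1 q.1) (g := fun q => edist q.1 q.2.2)
    (by fun_prop) (by fun_prop) (by norm_num)
  rw [i₁, i₂]
  simp only [ENNReal.rpow_ofNat, Pi.add_apply] at mink
  refine le_trans ?_ mink
  rw [wasserstein]
  gcongr
  refine key.trans (lintegral_mono fun q => ?_)
  dsimp only
  gcongr
  exact edist_triangle _ _ _

/-- Mass common to both measures need not be moved. -/
theorem transportCost_add_le (m r s : Measure X) [IsFiniteMeasure r] [IsFiniteMeasure s]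
    (h : r Set.univ = s Set.univ) :
    transportCost (m + r) (m + s) ≤
      (r Set.univ)⁻¹ * ∫⁻ p, edist p.1 p.2 ^ 2 ∂(r.prod s) := by
  have hd : Measurable fun x : X => (x, x) := by fun_prop
  have hfst : (m.map fun x : X => (x, x)).fst = m := by
    rw [Measure.fst, Measure.map_map measurable_fst hd]; exact Measure.map_id
  have hsnd : (m.map fun x : X => (x, x)).snd = m := by
    rw [Measure.snd, Measure.map_map measurable_snd hd]; exact Measure.map_id

  -- The factor is infinite when `r = 0`, but then it multiplies the zero measure.
  have hr : ((r Set.univ)⁻¹ • r.prod s).fst = r := by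
    rw [Measure.fst, Measure.map_smul, Measure.map_fst_prod, ← h, smul_smul]
    by_cases h0 : r = 0
    · simp [h0]
    · rw [ENNReal.inv_mul_cancel (by simpa using h0) (measure_ne_top _ _), one_smul]
  have hs : ((r Set.univ)⁻¹ • r.prod s).snd = s := by
    rw [Measure.snd, Measure.map_smul, Measure.map_snd_prod, smul_smul]
    by_cases h0 : r = 0
    · have : s = 0 := by rw [← Measure.measure_univ_eq_zero, ← h, h0]; simp
      simp [this]
    · rw [ENNReal.inv_mul_cancel (by simpa using h0) (measure_ne_top _ _), one_smul]
  -- The common part `m` sits on the diagonal at no cost; the rest is coupled by the normalised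
  -- product.
  refine (transportCost_le (m.map (fun x => (x, x)) + (r Set.univ)⁻¹ • r.prod s) ?_ ?_).trans_eq ?_
  · rw [Measure.fst_add, hfst, hr]
  · rw [Measure.snd_add, hsnd, hs]
  · rw [lintegral_add_measure, lintegral_map measurable_edist_sq hd, lintegral_smul_measure]
    simp

theorem transportCost_map_le (ν : Measure X) {T : X → X} (hT : Measurable T) :
    transportCost ν (ν.map T) ≤ ∫⁻ x, edist x (T x) ^ 2 ∂ν := by
  have hd : Measurable fun x : X => (x, T x) := by fun_prop
  refine (transportCost_le (ν.map fun x => (x, T x)) ?_ ?_).trans_eq ?_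
  · rw [Measure.fst, Measure.map_map measurable_fst hd]; exact Measure.map_id
  · rw [Measure.snd, Measure.map_map measurable_snd hd]; rfl
  · rw [lintegral_map measurable_edist_sq hd]

end Couplings

/-! ### Lipschitz continuity of the distance to the empirical measure. -/

section Empirical

variable {X : Type*} [MeasurableSpace X]
theorem isProbabilityMeasure_empiricalMeasure {n : ℕ} (hn : 0 < n) (x : Fin n → X) :
    IsProbabilityMeasure (empiricalMeasure x) := by
  constructor
  simp only [empiricalMeasure, Measure.smul_apply, Measure.finsetSum_apply, measure_univ,
    Finset.sum_const, Finset.card_univ, Fintype.card_fin, smul_eq_mul, nsmul_eq_mul, mul_one]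
  exact ENNReal.inv_mul_cancel (by simpa using hn.ne') (by simp)


theorem lintegral_empiricalMeasure {n : ℕ} (x : Fin n → X) {f : X → ℝ≥0∞} (hf : Measurable f) :
    ∫⁻ z, f z ∂empiricalMeasure x = (n : ℝ≥0∞)⁻¹ * ∑ i, f (x i) := by
  simp [empiricalMeasure, lintegral_finsetSum_measure, lintegral_dirac' _ hf]

variable [MetricSpace X] [BorelSpace X] [SecondCountableTopology X]

/-- Pair the `i`-th points. Not optimal over permutations, but enough for the Lipschitz constant of
`F_n`. -/
theorem transportCost_empiricalMeasure_le {n : ℕ} (x y : Fin n → X) :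
    transportCost (empiricalMeasure x) (empiricalMeasure y) ≤
      (n : ℝ≥0∞)⁻¹ * ∑ i, edist (x i) (y i) ^ 2 := by
  refine (transportCost_le ((n : ℝ≥0∞)⁻¹ • ∑ i, Measure.dirac (x i, y i)) ?_ ?_).trans_eq ?_
  · rw [Measure.fst, Measure.map_smul, Measure.map_finset_sum (by fun_prop), empiricalMeasure]
    simp [Measure.map_dirac' measurable_fst]
  · rw [Measure.snd, Measure.map_smul, Measure.map_finset_sum (by fun_prop), empiricalMeasure]
    simp [Measure.map_dirac' measurable_snd]
  · simp [lintegral_finsetSum_measure, lintegral_dirac' _ measurable_edist_sq]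

/-- The product-type bound for the cost, in terms of second moments. -/
theorem transportCost_prod_le (ν₁ ν₂ : Measure X) [IsProbabilityMeasure ν₁]
    [IsProbabilityMeasure ν₂] (x₀ : X) :
    transportCost ν₁ ν₂ ≤
      2 * (∫⁻ x, edist x₀ x ^ 2 ∂ν₁ + ∫⁻ x, edist x₀ x ^ 2 ∂ν₂) := by
  refine (transportCost_le (ν₁.prod ν₂) Measure.fst_prod Measure.snd_prod).trans ?_
  calc ∫⁻ p, edist p.1 p.2 ^ 2 ∂(ν₁.prod ν₂)
      ≤ ∫⁻ p, 2 * (edist x₀ p.1 ^ 2 + edist x₀ p.2 ^ 2) ∂(ν₁.prod ν₂) := by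
        refine lintegral_mono fun p => ?_
        have h1 : edist p.1 p.2 ≤ edist x₀ p.1 + edist x₀ p.2 := by
          rw [edist_comm x₀ p.1]; exact edist_triangle _ _ _
        have h2 := ENNReal.rpow_add_le_mul_rpow_add_rpow (edist x₀ p.1) (edist x₀ p.2)
          (p := 2) (by norm_num)
        norm_num at h2
        exact (pow_le_pow_left' h1 2).trans h2
    _ = _ := by
        rw [lintegral_const_mul _ (by fun_prop), lintegral_add_left (by fun_prop)]
        congr 2
        · conv_rhs => rw [← Measure.fst_prod (μ := ν₁) (ν := ν₂)]
          rw [Measure.fst, lintegral_map (by fun_prop) (by fun_prop)]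
        · conv_rhs => rw [← Measure.snd_prod (μ := ν₁) (ν := ν₂)]
          rw [Measure.snd, lintegral_map (by fun_prop) (by fun_prop)]

theorem wasserstein_empiricalMeasure_ne_top {ν : Measure X} [IsProbabilityMeasure ν]
    (hν : HasFiniteSecondMoment ν) {n : ℕ} (hn : 0 < n) (x : Fin n → X) :
    wasserstein (empiricalMeasure x) ν ≠ ⊤ := by
  obtain ⟨x₀, hx₀⟩ := hν
  have := isProbabilityMeasure_empiricalMeasure hn x
  have h := transportCost_prod_le (empiricalMeasure x) ν x₀
  refine ENNReal.rpow_ne_top_of_nonneg (by norm_num) (ne_top_of_le_ne_top ?_ h)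
  rw [lintegral_empiricalMeasure x (by fun_prop)]
  refine ENNReal.mul_ne_top (by norm_num) (ENNReal.add_ne_top.2 ⟨?_, hx₀.ne⟩)
  refine ENNReal.mul_ne_top (by simpa using hn.ne') ?_
  exact ENNReal.sum_ne_top.2 fun i _ => ENNReal.pow_ne_top (edist_ne_top _ _)

theorem ofReal_empiricalDist {ν : Measure X} [IsProbabilityMeasure ν]
    (hν : HasFiniteSecondMoment ν) {n : ℕ} (hn : 0 < n) (x : Fin n → X) :
    ENNReal.ofReal (empiricalDist ν n x) = wasserstein (empiricalMeasure x) ν :=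
  ENNReal.ofReal_toReal (wasserstein_empiricalMeasure_ne_top hν hn x)

variable [StandardBorelSpace X]

/-- The `ℓ²` Lipschitz constant `n^{-1/2}` is the only information about `F_n` from which `(∗)` is
later derived. -/
theorem empiricalDist_sub_le {ν : Measure X} [IsProbabilityMeasure ν]
    (hν : HasFiniteSecondMoment ν) {n : ℕ} (hn : 0 < n) (x y : Fin n → X) :
    |empiricalDist ν n x - empiricalDist ν n y| ≤ √((n : ℝ)⁻¹ * ∑ i, dist (x i) (y i) ^ 2) := by
  suffices h : ∀ x y : Fin n → X, empiricalDist ν n x - empiricalDist ν n y ≤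
      √((n : ℝ)⁻¹ * ∑ i, dist (x i) (y i) ^ 2) by
    refine abs_sub_le_iff.2 ⟨h x y, ?_⟩
    simpa only [dist_comm] using h y x
  intro x y
  have := isProbabilityMeasure_empiricalMeasure hn x
  have := isProbabilityMeasure_empiricalMeasure hn y
  have h := wasserstein_triangle (empiricalMeasure x) (empiricalMeasure y) ν
  have h2 : wasserstein (empiricalMeasure x) (empiricalMeasure y) ≤
      ENNReal.ofReal (√((n : ℝ)⁻¹ * ∑ i, dist (x i) (y i) ^ 2)) := by
    rw [wasserstein, Real.sqrt_eq_rpow, ← ENNReal.ofReal_rpow_of_nonneg (by positivity)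
      (by norm_num)]
    gcongr
    refine (transportCost_empiricalMeasure_le x y).trans_eq ?_
    rw [ENNReal.ofReal_mul (by positivity), ENNReal.ofReal_sum_of_nonneg
      (fun i _ => by positivity), ENNReal.ofReal_inv_of_pos (by positivity)]
    simp [edist_dist, ENNReal.ofReal_pow]
  rw [sub_le_iff_le_add]
  have h3 := h.trans (add_le_add_left h2 _)
  rw [← ofReal_empiricalDist hν hn, ← ofReal_empiricalDist hν hn,
    ← ENNReal.ofReal_add (by positivity) (by exact ENNReal.toReal_nonneg)] at h3
  exact (ENNReal.ofReal_le_ofReal_iff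
    (add_nonneg (by positivity) (by exact ENNReal.toReal_nonneg))).1 h3

/-- Here `Fin n → X` carries the sup distance, which dominates the quadratic mean. This cruder form
serves continuity, measurability and Rademacher. -/
theorem lipschitzWith_empiricalDist {ν : Measure X} [IsProbabilityMeasure ν]
    (hν : HasFiniteSecondMoment ν) {n : ℕ} (hn : 0 < n) :
    LipschitzWith 1 (empiricalDist ν n) := by
  refine LipschitzWith.of_dist_le_mul fun x y => ?_
  rw [Real.dist_eq, NNReal.coe_one, one_mul]
  refine (empiricalDist_sub_le hν hn x y).trans ?_
  rw [← Real.sqrt_sq (dist_nonneg (x := x) (y := y))]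
  refine Real.sqrt_le_sqrt ?_
  rw [inv_mul_le_iff₀ (by positivity)]
  calc ∑ i, dist (x i) (y i) ^ 2 ≤ ∑ i : Fin n, dist x y ^ 2 := by
        gcongr with i; exact dist_le_pi_dist x y i
    _ = _ := by simp

end Empirical

/-! ### Empirical frequencies of a fixed event. -/

section Frequencies

variable {X : Type*} [MeasurableSpace X]

theorem empiricalMeasure_apply_eq_ofReal {n : ℕ} (hn : 0 < n) {A : Set X} (hA : MeasurableSet A)
    (x : Fin n → X) :
    empiricalMeasure x A = ENNReal.ofReal ((n : ℝ)⁻¹ * ∑ i, A.indicator 1 (x i)) := by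
  rw [ENNReal.ofReal_mul (by positivity), ENNReal.ofReal_inv_of_pos (by positivity),
    ENNReal.ofReal_sum_of_nonneg (fun i _ => Set.indicator_nonneg (by simp) _)]
  simp only [empiricalMeasure, Measure.smul_apply, Measure.finsetSum_apply, smul_eq_mul,
    ENNReal.ofReal_natCast, Measure.dirac_apply' _ hA]
  congr 2 with i
  by_cases h : x i ∈ A <;> simp [h]

/-- By independence the number of visits to `A` has variance at most `n`, so the frequency has
standard deviation at most `n^{-1/2}`. -/
theorem integral_abs_frequency_sub_le (ν : Measure X) [IsProbabilityMeasure ν] {A : Set X}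
    (hA : MeasurableSet A) {n : ℕ} (hn : 0 < n) :
    ∫ x, |(n : ℝ)⁻¹ * ∑ i, A.indicator 1 (x i) - ν.real A| ∂(Measure.pi fun _ : Fin n => ν) ≤
      √((n : ℝ)⁻¹) := by
  set P := Measure.pi fun _ : Fin n => ν
  have hn' : (0 : ℝ) < n := by exact_mod_cast hn
  have hind : Measurable (A.indicator (1 : X → ℝ)) := measurable_one.indicator hA
  have hb : ∀ z, |A.indicator (1 : X → ℝ) z| ≤ 1 := fun z => by
    by_cases h : z ∈ A <;> simp [h]
  have hmem : MemLp (A.indicator (1 : X → ℝ)) 2 ν :=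
    MemLp.of_bound hind.aestronglyMeasurable 1 (ae_of_all _ hb)
  set S : (Fin n → X) → ℝ := ∑ i, fun x : Fin n → X => A.indicator (1 : X → ℝ) (x i) with hS
  have hSmem : MemLp S 2 P := memLp_finsetSum' _ fun i _ =>
    hmem.comp_measurePreserving (measurePreserving_eval (fun _ : Fin n => ν) i)
  have hES : P[S] = n * ν.real A := by
    simp only [hS, Finset.sum_apply]
    rw [integral_finsetSum]
    · have : ∀ i : Fin n, ∫ x : Fin n → X, A.indicator (1 : X → ℝ) (x i) ∂P = ν.real A := by
        intro i
        rw [← integral_indicator_one hA]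
        rw [← (measurePreserving_eval (fun _ : Fin n => ν) i).map_eq,
          integral_map (measurable_pi_apply i).aemeasurable hind.aestronglyMeasurable]
      simp [this]
    · intro i _
      exact (hmem.comp_measurePreserving
        (measurePreserving_eval (fun _ : Fin n => ν) i)).integrable (by norm_num)
  have hvar : Var[S; P] ≤ n := by
    rw [hS, ProbabilityTheory.variance_sum_pi (fun _ => hmem)]
    calc ∑ i : Fin n, Var[A.indicator (1 : X → ℝ); ν] ≤ ∑ i : Fin n, 1 := by
          gcongr with i
          refine (ProbabilityTheory.variance_le_expectation_sq hind.aestronglyMeasurable).trans ?_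
          calc ∫ z, (A.indicator (1 : X → ℝ) ^ 2) z ∂ν ≤ ∫ z, (1 : ℝ) ∂ν := by
                refine integral_mono_of_nonneg (ae_of_all _ fun z => sq_nonneg _)
                  (integrable_const _) (ae_of_all _ fun z => ?_)
                simpa using (sq_le_one_iff_abs_le_one _).2 (hb z)
            _ = 1 := by simp
      _ = n := by simp
  rw [ProbabilityTheory.variance_eq_integral hSmem.aemeasurable, hES] at hvar
  have hint : Integrable (fun x => (S x - n * ν.real A) ^ 2) P :=
    (hSmem.sub (memLp_const _)).integrable_sq
  have hint1 : Integrable (fun x => S x - n * ν.real A) P :=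
    (hSmem.integrable (by norm_num)).sub (integrable_const _)
  -- Cauchy–Schwarz is replaced by `t |D| ≤ (1 + t² D²) / 2` for `D = S - n ν(A)`, with `t =
  -- n^{-1/2}` balancing the two terms.
  set t := √((n : ℝ)⁻¹) with ht
  have htpos : 0 < t := by positivity
  have htn : t ^ 2 * n = 1 := by
    rw [ht, Real.sq_sqrt (by positivity)]; field_simp
  calc ∫ x, |(n : ℝ)⁻¹ * ∑ i, A.indicator 1 (x i) - ν.real A| ∂P
      ≤ ∫ x, (t / 2 + (t / (2 * n)) * (S x - n * ν.real A) ^ 2) ∂P := by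
        refine integral_mono_of_nonneg (ae_of_all _ fun x => abs_nonneg _)
          ((integrable_const _).add (hint.const_mul _)) (ae_of_all _ fun x => ?_)
        have e : (n : ℝ)⁻¹ * ∑ i, A.indicator 1 (x i) - ν.real A
            = t ^ 2 * (S x - n * ν.real A) := by
          have : (n : ℝ)⁻¹ = t ^ 2 := by
            rw [ht, Real.sq_sqrt (by positivity)]
          simp only [hS, Finset.sum_apply, this]
          linear_combination ν.real A * htn
        have e2 : t / (2 * n) = t ^ 3 / 2 := by
          field_simp; linear_combination -htn
        dsimp only
        rw [e, e2, abs_mul, abs_of_pos (by positivity), ← sq_abs (S x - n * ν.real A)]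
        nlinarith [mul_nonneg htpos.le (sq_nonneg (1 - t * |S x - n * ν.real A|))]
    _ = t / 2 + (t / (2 * n)) * ∫ x, (S x - n * ν.real A) ^ 2 ∂P := by
        rw [integral_add (integrable_const _) (hint.const_mul _), integral_const_mul]
        simp
    _ ≤ t / 2 + (t / (2 * n)) * n := by gcongr
    _ = t := by field_simp; ring

/-- Truncated subtraction keeps only the positive part: the excess mass, which is what has to be
transported. -/
theorem lintegral_frequency_sub_le (ν : Measure X) [IsProbabilityMeasure ν] {A : Set X}
    (hA : MeasurableSet A) {n : ℕ} (hn : 0 < n) :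
    ∫⁻ x, (empiricalMeasure x A - ν A) ∂(Measure.pi fun _ : Fin n => ν) ≤
      ENNReal.ofReal √((n : ℝ)⁻¹) := by
  have hmeas : Measurable fun x : Fin n → X =>
      (n : ℝ)⁻¹ * ∑ i, A.indicator (1 : X → ℝ) (x i) - ν.real A := by
    have hind : Measurable (A.indicator (1 : X → ℝ)) := measurable_one.indicator hA
    fun_prop
  refine le_trans ?_ (ENNReal.ofReal_le_ofReal (integral_abs_frequency_sub_le ν hA hn))
  rw [ofReal_integral_eq_lintegral_ofReal]
  · refine lintegral_mono fun x => ?_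
    rw [empiricalMeasure_apply_eq_ofReal hn hA, ← ofReal_measureReal (μ := ν) (s := A),
      ← ENNReal.ofReal_sub _ measureReal_nonneg]
    exact ENNReal.ofReal_le_ofReal (le_abs_self _)
  · refine Integrable.of_bound hmeas.abs.aestronglyMeasurable 2 (ae_of_all _ fun x => ?_)
    have h0 : 0 ≤ (n : ℝ)⁻¹ * ∑ i, A.indicator (1 : X → ℝ) (x i) :=
      mul_nonneg (by positivity) (Finset.sum_nonneg fun i _ => Set.indicator_nonneg (by simp) _)
    have h1 : (n : ℝ)⁻¹ * ∑ i, A.indicator (1 : X → ℝ) (x i) ≤ 1 := by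
      rw [inv_mul_le_iff₀ (by positivity)]
      calc ∑ i, A.indicator (1 : X → ℝ) (x i) ≤ ∑ i : Fin n, (1 : ℝ) := by
            gcongr with i; exact Set.indicator_le_self' (by simp) _
        _ = _ := by simp
    have h2 := measureReal_nonneg (μ := ν) (s := A)
    have h3 := measureReal_le_one (μ := ν) (s := A)
    rw [Real.norm_eq_abs, abs_abs, abs_le]
    constructor <;> linarith
  · exact ae_of_all _ fun x => abs_nonneg _

theorem map_simpleFunc_eq_sum {Y : Type*} [MeasurableSpace Y] (ν : Measure X)
    (T : SimpleFunc X Y) (hT : Measurable T) :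
    ν.map T = ∑ y ∈ T.range, ν (T ⁻¹' {y}) • Measure.dirac y := by
  refine Measure.ext_of_lintegral _ fun f hf => ?_
  rw [lintegral_map hf hT, lintegral_finsetSum_measure]
  simp only [lintegral_smul_measure, lintegral_dirac' _ hf, smul_eq_mul]
  have h := SimpleFunc.map_lintegral (μ := ν) f T
  rw [← SimpleFunc.lintegral_eq_lintegral] at h
  simp only [SimpleFunc.coe_map, Function.comp_apply] at h
  rw [h]
  simp [mul_comm]

end Frequencies

/-! ### Convergence in mean of empirical measures for the transportation cost. -/

section LawOfLargeNumbers

variable {X : Type*} [MetricSpace X] [MeasurableSpace X] [BorelSpace X]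
  [SecondCountableTopology X]

/-- Both images live on a finite set. At each atom the smaller of the two masses stays put, and only
the excess travels, over a distance at most `D`. -/
theorem transportCost_map_simpleFunc_le (ν₁ ν₂ : Measure X) [IsProbabilityMeasure ν₁]
    [IsProbabilityMeasure ν₂] (T : SimpleFunc X X) {D : ℝ≥0∞}
    (hD : ∀ y ∈ T.range, ∀ z ∈ T.range, edist y z ≤ D) :
    transportCost (ν₁.map T) (ν₂.map T) ≤
      D ^ 2 * ∑ y ∈ T.range, (ν₁ (T ⁻¹' {y}) - ν₂ (T ⁻¹' {y})) := by
  have hT : Measurable T := T.measurable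
  set p := fun y => ν₁ (T ⁻¹' {y})
  set q := fun y => ν₂ (T ⁻¹' {y})
  set m : Measure X := ∑ y ∈ T.range, min (p y) (q y) • Measure.dirac y with hm
  set r : Measure X := ∑ y ∈ T.range, (p y - q y) • Measure.dirac y with hr
  set s : Measure X := ∑ y ∈ T.range, (q y - p y) • Measure.dirac y with hs
  have e₁ : ν₁.map T = m + r := by
    rw [map_simpleFunc_eq_sum _ _ hT, hm, hr, ← Finset.sum_add_distrib]
    refine Finset.sum_congr rfl fun y _ => ?_
    rw [← add_smul, add_comm, tsub_add_min]
  have e₂ : ν₂.map T = m + s := by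
    rw [map_simpleFunc_eq_sum _ _ hT, hm, hs, ← Finset.sum_add_distrib]
    refine Finset.sum_congr rfl fun y _ => ?_
    rw [← add_smul, add_comm, min_comm, tsub_add_min]
  have hru : r Set.univ = ∑ y ∈ T.range, (p y - q y) := by
    simp [hr, Measure.finsetSum_apply]
  have hsu : s Set.univ = ∑ y ∈ T.range, (q y - p y) := by
    simp [hs, Measure.finsetSum_apply]
  have hmr : m Set.univ + r Set.univ = 1 := by
    rw [← Measure.add_apply, ← e₁, Measure.map_apply hT .univ]; simp
  have hms : m Set.univ + s Set.univ = 1 := by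
    rw [← Measure.add_apply, ← e₂, Measure.map_apply hT .univ]; simp
  have hm' : m Set.univ ≠ ⊤ := ne_top_of_le_ne_top ENNReal.one_ne_top (hmr ▸ le_self_add)
  have hr' : IsFiniteMeasure r := ⟨lt_of_le_of_lt (hmr ▸ le_add_self) ENNReal.one_lt_top⟩
  have hs' : IsFiniteMeasure s := ⟨lt_of_le_of_lt (hms ▸ le_add_self) ENNReal.one_lt_top⟩
  have hrs : r Set.univ = s Set.univ := (ENNReal.add_right_inj hm').1 (hmr.trans hms.symm)
  rw [e₁, e₂]
  refine (transportCost_add_le m r s hrs).trans ?_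
  have hint : ∫⁻ z, edist z.1 z.2 ^ 2 ∂(r.prod s) ≤ r Set.univ * (s Set.univ * D ^ 2) := by
    rw [lintegral_prod _ (by fun_prop)]
    have inner : ∀ y ∈ T.range, ∫⁻ z, edist y z ^ 2 ∂s ≤ s Set.univ * D ^ 2 := by
      intro y hy
      rw [hsu, hs, lintegral_finsetSum_measure, Finset.sum_mul]
      refine Finset.sum_le_sum fun z hz => ?_
      rw [lintegral_smul_measure, lintegral_dirac' _ (by fun_prop), smul_eq_mul]
      gcongr
      exact hD y hy z hz
    conv_lhs => rw [hr, lintegral_finsetSum_measure]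
    rw [hru, Finset.sum_mul]
    refine Finset.sum_le_sum fun y hy => ?_
    rw [lintegral_smul_measure, lintegral_dirac' _ (by fun_prop), smul_eq_mul]
    gcongr
    exact inner y hy
  rw [← hru]
  calc (r Set.univ)⁻¹ * ∫⁻ z, edist z.1 z.2 ^ 2 ∂(r.prod s)
      ≤ (r Set.univ)⁻¹ * (r Set.univ * (s Set.univ * D ^ 2)) := by gcongr
    _ ≤ 1 * (s Set.univ * D ^ 2) := by
        rw [← mul_assoc]; gcongr; exact ENNReal.inv_mul_le_one _
    _ = _ := by rw [one_mul, ← hrs, mul_comm]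

/-- The standard approximations are never farther from `x` than the base point `x₀` is, so the
second moment dominates and the errors tend to zero. -/
theorem exists_simpleFunc_lintegral_edist_sq_lt {ν : Measure X} (hν : HasFiniteSecondMoment ν)
    {ε : ℝ≥0∞} (hε : 0 < ε) : ∃ T : SimpleFunc X X, ∫⁻ x, edist x (T x) ^ 2 ∂ν < ε := by
  obtain ⟨x₀, hx₀⟩ := hν
  set T : ℕ → SimpleFunc X X :=
    fun k => SimpleFunc.approxOn id measurable_id Set.univ x₀ (Set.mem_univ _) k
  have h : Tendsto (fun k => ∫⁻ x, edist x (T k x) ^ 2 ∂ν) atTop (𝓝 (∫⁻ _, 0 ∂ν)) := by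
    refine tendsto_lintegral_of_dominated_convergence (fun x => edist x₀ x ^ 2)
      (fun k => ?_) (fun k => ae_of_all _ fun x => ?_) hx₀.ne (ae_of_all _ fun x => ?_)
    · have := (T k).measurable
      fun_prop
    · dsimp only
      rw [edist_comm]
      gcongr
      exact SimpleFunc.edist_approxOn_le measurable_id (Set.mem_univ x₀) x k
    · have h1 := SimpleFunc.tendsto_approxOn measurable_id (Set.mem_univ x₀) (x := x) (by simp)
      have h2 : Tendsto (fun k => edist x (T k x)) atTop (𝓝 (edist x x)) :=
        tendsto_const_nhds.edist h1
      rw [edist_self] at h2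
      simpa using ENNReal.Tendsto.pow (n := 2) h2
  rw [lintegral_zero] at h
  obtain ⟨k, hk⟩ := (h.eventually_lt_const hε).exists
  exact ⟨T k, hk⟩

theorem transportCost_le_of_intermediate [StandardBorelSpace X] (ν₁ ν₂ ν₃ ν₄ : Measure X)
    [IsFiniteMeasure ν₁] [IsFiniteMeasure ν₂] [IsFiniteMeasure ν₃] :
    transportCost ν₁ ν₄ ≤
      4 * (transportCost ν₁ ν₂ + transportCost ν₂ ν₃ + transportCost ν₃ ν₄) := by
  have sq : ∀ a b : ℝ≥0∞, (a + b) ^ 2 ≤ 2 * (a ^ 2 + b ^ 2) := fun a b => by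
    have := ENNReal.rpow_add_le_mul_rpow_add_rpow a b (p := 2) (by norm_num)
    norm_num at this
    exact this
  simp only [← wasserstein_sq]
  have h := (wasserstein_triangle ν₁ ν₂ ν₄).trans
    (add_le_add_right (wasserstein_triangle ν₂ ν₃ ν₄) _)
  calc wasserstein ν₁ ν₄ ^ 2
      ≤ (wasserstein ν₁ ν₂ + (wasserstein ν₂ ν₃ + wasserstein ν₃ ν₄)) ^ 2 := by gcongr
    _ ≤ 2 * (wasserstein ν₁ ν₂ ^ 2 + (wasserstein ν₂ ν₃ + wasserstein ν₃ ν₄) ^ 2) := sq _ _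
    _ ≤ 2 * (2 * wasserstein ν₁ ν₂ ^ 2 +
          2 * (wasserstein ν₂ ν₃ ^ 2 + wasserstein ν₃ ν₄ ^ 2)) := by
        gcongr
        · exact le_mul_of_one_le_left' (by norm_num)
        · exact sq _ _
    _ = _ := by ring

variable [StandardBorelSpace X]

/-- Pass from `L_n` to `ν` through their images under `T`. The two outer costs are discretisation
errors, equal in mean because each sample point has law `ν`; the middle one is governed by
frequencies of finitely many cells. -/
theorem lintegral_transportCost_empiricalMeasure_le (ν : Measure X) [IsProbabilityMeasure ν]
    (T : SimpleFunc X X) {D : ℝ≥0∞} (hD : ∀ y ∈ T.range, ∀ z ∈ T.range, edist y z ≤ D)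
    {n : ℕ} (hn : 0 < n) :
    ∫⁻ x, transportCost (empiricalMeasure x) ν ∂(Measure.pi fun _ : Fin n => ν) ≤
      4 * (∫⁻ x, edist x (T x) ^ 2 ∂ν +
        D ^ 2 * (T.range.card * ENNReal.ofReal √((n : ℝ)⁻¹)) + ∫⁻ x, edist x (T x) ^ 2 ∂ν) := by
  set P := Measure.pi fun _ : Fin n => ν
  have hT : Measurable T := T.measurable
  have hfreq : ∀ y, Measurable fun x : Fin n → X => empiricalMeasure x (T ⁻¹' {y}) := by
    intro y
    have hA : MeasurableSet (T ⁻¹' {y}) := T.measurableSet_fiber y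
    have hind : Measurable ((T ⁻¹' {y}).indicator (1 : X → ℝ)) := measurable_one.indicator hA
    simp_rw [empiricalMeasure_apply_eq_ofReal hn hA]
    fun_prop
  calc ∫⁻ x, transportCost (empiricalMeasure x) ν ∂P
      ≤ ∫⁻ x, 4 * ((n : ℝ≥0∞)⁻¹ * ∑ i, edist (x i) (T (x i)) ^ 2 +
          D ^ 2 * ∑ y ∈ T.range, (empiricalMeasure x (T ⁻¹' {y}) - ν (T ⁻¹' {y})) +
          ∫⁻ x, edist x (T x) ^ 2 ∂ν) ∂P := by
        refine lintegral_mono fun x => ?_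
        have := isProbabilityMeasure_empiricalMeasure hn x
        refine (transportCost_le_of_intermediate _ ((empiricalMeasure x).map T) (ν.map T) _).trans
          ?_
        gcongr
        · refine (transportCost_map_le _ hT).trans_eq ?_
          rw [lintegral_empiricalMeasure x (by fun_prop)]
        · exact transportCost_map_simpleFunc_le _ _ T hD
        · rw [transportCost_comm]; exact transportCost_map_le _ hT
    _ = 4 * ((n : ℝ≥0∞)⁻¹ * ∑ i : Fin n, ∫⁻ x, edist (x i) (T (x i)) ^ 2 ∂P +
          D ^ 2 * ∑ y ∈ T.range, ∫⁻ x, (empiricalMeasure x (T ⁻¹' {y}) - ν (T ⁻¹' {y})) ∂P +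
          ∫⁻ x, edist x (T x) ^ 2 ∂ν) := by
        rw [lintegral_const_mul _ (by fun_prop), lintegral_add_right _ measurable_const,
          lintegral_add_right _ (by fun_prop), lintegral_const_mul _ (by fun_prop),
          lintegral_const_mul _ (by fun_prop), lintegral_finsetSum _ (by fun_prop),
          lintegral_finsetSum _ (by fun_prop)]
        simp
    _ ≤ _ := by
        gcongr
        · have : ∀ i : Fin n, ∫⁻ x, edist (x i) (T (x i)) ^ 2 ∂P = ∫⁻ x, edist x (T x) ^ 2 ∂ν :=
            fun i => (measurePreserving_eval (fun _ : Fin n => ν) i).lintegral_comp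
              (f := fun z => edist z (T z) ^ 2) (by fun_prop)
          simp only [this, Finset.sum_const, Finset.card_univ, Fintype.card_fin, nsmul_eq_mul]
          rw [← mul_assoc, ENNReal.inv_mul_cancel (by simpa using hn.ne') (by simp), one_mul]
        · rw [← nsmul_eq_mul]
          refine Finset.sum_le_card_nsmul _ _ _ fun y _ => ?_
          exact lintegral_frequency_sub_le ν (T.measurableSet_fiber y) hn

theorem tendsto_lintegral_transportCost_empiricalMeasure {ν : Measure X} [IsProbabilityMeasure ν]
    (hν : HasFiniteSecondMoment ν) :
    Tendsto (fun n : ℕ => ∫⁻ x, transportCost (empiricalMeasure x) ν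
      ∂(Measure.pi fun _ : Fin n => ν)) atTop (𝓝 0) := by
  rw [ENNReal.tendsto_nhds_zero]
  intro ε hε
  -- Three terms below `ε / 16`, multiplied by `4`, stay below `ε`.
  obtain ⟨T, hT⟩ := exists_simpleFunc_lintegral_edist_sq_lt hν
    (ε := ε / 16) (ENNReal.div_pos hε.ne' (by norm_num))
  set D : ℝ≥0∞ := (T.range ×ˢ T.range).sup fun p => edist p.1 p.2 with hDdef
  have hD : ∀ y ∈ T.range, ∀ z ∈ T.range, edist y z ≤ D := fun y hy z hz =>
    Finset.le_sup (f := fun p : X × X => edist p.1 p.2) (Finset.mk_mem_product hy hz)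
  have hDtop : D ≠ ⊤ := by
    refine ne_of_lt ((Finset.sup_lt_iff (by simp)).2 fun p _ => ?_)
    exact edist_lt_top _ _
  have hlim : Tendsto (fun n : ℕ => D ^ 2 * (T.range.card * ENNReal.ofReal √((n : ℝ)⁻¹)))
      atTop (𝓝 0) := by
    have h1 : Tendsto (fun n : ℕ => ENNReal.ofReal √((n : ℝ)⁻¹)) atTop (𝓝 0) := by
      rw [← ENNReal.ofReal_zero, ← Real.sqrt_zero]
      exact ENNReal.tendsto_ofReal
        ((Real.continuous_sqrt.tendsto _).comp tendsto_inv_atTop_nhds_zero_nat)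
    have h2 := ENNReal.Tendsto.const_mul (a := (T.range.card : ℝ≥0∞)) h1 (Or.inr (by simp))
    have h3 := ENNReal.Tendsto.const_mul (a := D ^ 2) h2 (Or.inr (ENNReal.pow_ne_top hDtop))
    simpa using h3
  filter_upwards [eventually_gt_atTop 0, hlim.eventually_lt_const
    (u := ε / 16) (ENNReal.div_pos hε.ne' (by norm_num))] with n hn hlt
  refine (lintegral_transportCost_empiricalMeasure_le ν T hD hn).trans ?_
  calc _ ≤ 4 * (ε / 16 + ε / 16 + ε / 16) := by gcongr
    _ ≤ 4 * (ε / 16 + ε / 16 + ε / 16 + ε / 16) := by gcongr; exact le_self_add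
    _ = ε := by
      have : ε / 16 + ε / 16 + ε / 16 + ε / 16 = 4 * (ε / 16) := by ring
      rw [this, ← mul_assoc]
      norm_num
      exact ENNReal.mul_div_cancel (by norm_num) (by norm_num)

theorem tendsto_lintegral_wasserstein_empiricalMeasure {ν : Measure X} [IsProbabilityMeasure ν]
    (hν : HasFiniteSecondMoment ν) :
    Tendsto (fun n : ℕ => ∫⁻ x, wasserstein (empiricalMeasure x) ν
      ∂(Measure.pi fun _ : Fin n => ν)) atTop (𝓝 0) := by
  rw [ENNReal.tendsto_nhds_zero]
  intro ε hε
  wlog hε' : ε ≠ ⊤ generalizing ε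
  · simp [not_not.1 hε']
  have hε2 : ε / 2 ≠ 0 := (ENNReal.div_pos hε.ne' (by norm_num)).ne'
  have hε3 : ε / 2 ≠ ⊤ := ENNReal.div_ne_top hε' (by norm_num)
  have hlim := ENNReal.Tendsto.const_mul (a := (ε / 2)⁻¹)
    (tendsto_lintegral_transportCost_empiricalMeasure hν) (Or.inr (by simpa using hε.ne'))
  rw [mul_zero] at hlim
  filter_upwards [hlim.eventually_lt_const (u := ε / 2) (pos_iff_ne_zero.2 hε2)] with n hn
  -- The bound `W ≤ δ + W² / δ` with `δ = ε / 2` is used instead of Jensen, and needs no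
  -- measurability of the cost in `x`.
  calc _ ≤ ∫⁻ x, (ε / 2 + (ε / 2)⁻¹ * transportCost (empiricalMeasure x) ν)
        ∂(Measure.pi fun _ : Fin n => ν) := by
        refine lintegral_mono fun x => ?_
        dsimp only
        rw [← wasserstein_sq]
        set w := wasserstein (empiricalMeasure x) ν
        rcases le_total w (ε / 2) with h | h
        · exact h.trans le_self_add
        · refine le_add_left ?_
          calc w = (ε / 2)⁻¹ * (ε / 2) * w := by rw [ENNReal.inv_mul_cancel hε2 hε3, one_mul]
            _ ≤ (ε / 2)⁻¹ * w * w := by gcongr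
            _ = _ := by ring
    _ = ε / 2 + (ε / 2)⁻¹ * ∫⁻ x, transportCost (empiricalMeasure x) ν
        ∂(Measure.pi fun _ : Fin n => ν) := by
        rw [lintegral_add_left measurable_const, lintegral_const_mul' _ _ (by simpa using hε.ne')]
        simp
    _ ≤ ε / 2 + ε / 2 := by gcongr
    _ = ε := ENNReal.add_halves ε

end LawOfLargeNumbers

/-! ### Entropy: variational formula and tensorization. -/

section Entropy

theorem integrable_comp_of_mem_Icc {Ω : Type*} [MeasurableSpace Ω] (P : Measure Ω)
    [IsFiniteMeasure P] {g : Ω → ℝ} (hg : Measurable g) {a b : ℝ} (hab : ∀ x, g x ∈ Set.Icc a b)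
    {φ : ℝ → ℝ} (hφm : Measurable φ) (hφ : ContinuousOn φ (Set.Icc a b)) :
    Integrable (fun x => φ (g x)) P := by
  obtain ⟨K, hK⟩ := isCompact_Icc.exists_bound_of_continuousOn hφ
  exact Integrable.of_bound (hφm.comp hg).aestronglyMeasurable K
    (ae_of_all _ fun x => hK _ (hab x))

theorem integral_mem_Icc {Ω : Type*} [MeasurableSpace Ω] (P : Measure Ω)
    [IsProbabilityMeasure P] {g : Ω → ℝ} (hg : Measurable g) {a b : ℝ}
    (hab : ∀ x, g x ∈ Set.Icc a b) : ∫ x, g x ∂P ∈ Set.Icc a b := by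
  have hi : Integrable g P :=
    integrable_comp_of_mem_Icc P hg hab (φ := id) measurable_id continuousOn_id
  constructor
  · simpa using integral_mono (integrable_const a) hi fun x => (hab x).1
  · simpa using integral_mono hi (integrable_const b) fun x => (hab x).2

/-- Half of the variational formula for the entropy. -/
theorem integral_mul_le_ent {Ω : Type*} [MeasurableSpace Ω] (P : Measure Ω)
    [IsProbabilityMeasure P] {g : Ω → ℝ} (hg : Measurable g) {a b : ℝ} (ha : 0 < a)
    (hab : ∀ x, g x ∈ Set.Icc a b) {φ : Ω → ℝ} (hφ : Measurable φ) {K : ℝ}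
    (hφK : ∀ x, |φ x| ≤ K) (hφ1 : ∫ x, Real.exp (φ x) ∂P = 1) :
    ∫ x, g x * φ x ∂P ≤ ent P g := by
  have hi : Integrable g P :=
    integrable_comp_of_mem_Icc P hg hab (φ := id) measurable_id continuousOn_id
  have hil : Integrable (fun x => g x * Real.log (g x)) P :=
    integrable_comp_of_mem_Icc P hg hab (φ := fun u => u * Real.log u)
      Real.continuous_mul_log.measurable Real.continuous_mul_log.continuousOn
  have hie : Integrable (fun x => Real.exp (φ x)) P :=
    integrable_comp_of_mem_Icc P hφ (fun x => abs_le.1 (hφK x)) Real.measurable_exp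
      Real.continuous_exp.continuousOn
  have hip : Integrable (fun x => g x * φ x) P :=
    hi.mul_bdd hφ.aestronglyMeasurable (ae_of_all _ hφK)
  set m := ∫ x, g x ∂P with hm
  have hmpos : 0 < m := ha.trans_le (integral_mem_Icc P hg hab).1
  -- This is `1 + u ≤ exp u` at `u = φ - log g + log m`, multiplied by `g`. After integration `m ∫
  -- exp φ` and `∫ g` cancel.
  have hpt : ∀ x, g x * φ x ≤
      g x * Real.log (g x) - g x * Real.log m + m * Real.exp (φ x) - g x := by
    intro x
    have hgx : 0 < g x := ha.trans_le (hab x).1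
    have h1 := Real.add_one_le_exp (φ x - Real.log (g x) + Real.log m)
    rw [Real.exp_add, Real.exp_sub, Real.exp_log hgx, Real.exp_log hmpos] at h1
    have h2 := mul_le_mul_of_nonneg_left h1 hgx.le
    have h3 : g x * (Real.exp (φ x) / g x * m) = m * Real.exp (φ x) := by
      field_simp
    rw [h3] at h2
    nlinarith
  have i₁ : Integrable (fun x => g x * Real.log (g x) - g x * Real.log m) P :=
    hil.sub (hi.mul_const _)
  have i₂ : Integrable (fun x => g x * Real.log (g x) - g x * Real.log m + m * Real.exp (φ x)) P :=
    i₁.add (hie.const_mul _)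
  calc ∫ x, g x * φ x ∂P
      ≤ ∫ x, (g x * Real.log (g x) - g x * Real.log m + m * Real.exp (φ x) - g x) ∂P :=
        integral_mono hip (i₂.sub hi) hpt
    _ = ent P g := by
        rw [integral_sub i₂ hi, integral_add i₁ (hie.const_mul _),
          integral_sub hil (hi.mul_const _), integral_mul_const, integral_const_mul, hφ1, ent]
        ring

theorem ent_nonneg {Ω : Type*} [MeasurableSpace Ω] (P : Measure Ω)
    [IsProbabilityMeasure P] {g : Ω → ℝ} (hg : Measurable g) {a b : ℝ} (ha : 0 < a)
    (hab : ∀ x, g x ∈ Set.Icc a b) : 0 ≤ ent P g := by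
  simpa using integral_mul_le_ent P hg ha hab (φ := fun _ => 0) measurable_const (K := 0)
    (by simp) (by simp)

section Product

variable {A B : Type*} [MeasurableSpace A] [MeasurableSpace B]

theorem measurable_ent_right (β : Measure B) [SFinite β] {h : A × B → ℝ} (hh : Measurable h) :
    Measurable fun x => ent β fun y => h (x, y) := by
  have h1 : Measurable fun x => ∫ y, h (x, y) ∂β :=
    hh.stronglyMeasurable.integral_prod_right'.measurable
  have h2 : Measurable fun x => ∫ y, h (x, y) * Real.log (h (x, y)) ∂β :=
    (hh.mul (Real.measurable_log.comp hh)).stronglyMeasurable.integral_prod_right'.measurable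
  exact h2.sub (h1.mul (Real.measurable_log.comp h1))

variable (α : Measure A) (β : Measure B) [IsProbabilityMeasure α] [IsProbabilityMeasure β]

theorem integrable_ent_right {h : A × B → ℝ} (hh : Measurable h) {a b : ℝ}
    (hab : ∀ p, h p ∈ Set.Icc a b) : Integrable (fun x => ent β fun y => h (x, y)) α := by
  have h1 : Measurable fun x => ∫ y, h (x, y) ∂β :=
    hh.stronglyMeasurable.integral_prod_right'.measurable
  have hil : Integrable (fun p => h p * Real.log (h p)) (α.prod β) :=
    integrable_comp_of_mem_Icc _ hh hab (φ := fun u => u * Real.log u)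
      Real.continuous_mul_log.measurable Real.continuous_mul_log.continuousOn
  refine hil.integral_prod_left.sub ?_
  exact integrable_comp_of_mem_Icc α h1
    (fun x => integral_mem_Icc β (hh.comp measurable_prodMk_left) fun y => hab _)
    (φ := fun u => u * Real.log u)
    Real.continuous_mul_log.measurable Real.continuous_mul_log.continuousOn

/-- With `k` the average of `h` over `B`, the chain rule gives `Ent(h) = ∫ Ent_β(h(x, ·)) dα +
Ent_α(k)`. The last term equals `∫ h φ` with `φ = log (k / m)`. As `φ` depends on `x` only and `∫
exp φ dα = 1`, the variational formula bounds it slice by slice in `y`. -/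
theorem ent_prod_le {h : A × B → ℝ} (hh : Measurable h) {a b : ℝ} (ha : 0 < a)
    (hab : ∀ p, h p ∈ Set.Icc a b) :
    ent (α.prod β) h ≤ ∫ x, ent β (fun y => h (x, y)) ∂α + ∫ y, ent α (fun x => h (x, y)) ∂β := by
  set k : A → ℝ := fun x => ∫ y, h (x, y) ∂β with hk
  have hkm : Measurable k := hh.stronglyMeasurable.integral_prod_right'.measurable
  have hkab : ∀ x, k x ∈ Set.Icc a b := fun x =>
    integral_mem_Icc β (hh.comp measurable_prodMk_left) fun y => hab _
  have hkpos : ∀ x, 0 < k x := fun x => ha.trans_le (hkab x).1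
  have hi : Integrable h (α.prod β) :=
    integrable_comp_of_mem_Icc _ hh hab (φ := id) measurable_id continuousOn_id
  have hil : Integrable (fun p => h p * Real.log (h p)) (α.prod β) :=
    integrable_comp_of_mem_Icc _ hh hab (φ := fun u => u * Real.log u)
      Real.continuous_mul_log.measurable Real.continuous_mul_log.continuousOn
  have hkl : Integrable (fun x => k x * Real.log (k x)) α :=
    integrable_comp_of_mem_Icc _ hkm hkab (φ := fun u => u * Real.log u)
      Real.continuous_mul_log.measurable Real.continuous_mul_log.continuousOn
  have hki : Integrable k α := hi.integral_prod_left
  set m := ∫ p, h p ∂(α.prod β) with hm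
  have hmk : m = ∫ x, k x ∂α := integral_prod _ hi
  have hmpos : 0 < m := by
    rw [hmk]; exact ha.trans_le (integral_mem_Icc α hkm hkab).1
  have hfirst : ∫ x, ent β (fun y => h (x, y)) ∂α =
      ∫ p, h p * Real.log (h p) ∂(α.prod β) - ∫ x, k x * Real.log (k x) ∂α := by
    rw [integral_prod _ hil, ← integral_sub hil.integral_prod_left hkl]
    rfl
  have hdecomp : ent (α.prod β) h = ∫ x, ent β (fun y => h (x, y)) ∂α + ent α k := by
    rw [hfirst, ent, ent, ← hmk]; ring
  rw [hdecomp]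
  refine add_le_add le_rfl ?_
  set φ : A → ℝ := fun x => Real.log (k x / m) with hφ
  have hφm : Measurable φ := Real.measurable_log.comp (hkm.div_const m)
  obtain ⟨K, hK⟩ : ∃ K, ∀ x, |φ x| ≤ K := by
    obtain ⟨K, hK⟩ := isCompact_Icc.exists_bound_of_continuousOn (f := fun u => Real.log (u / m))
      (s := Set.Icc a b) (fun u hu => ContinuousAt.continuousWithinAt
        (ContinuousAt.log (by fun_prop) (div_pos (ha.trans_le hu.1) hmpos).ne'))
    exact ⟨K, fun x => hK _ (hkab x)⟩
  have hφ1 : ∫ x, Real.exp (φ x) ∂α = 1 := by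
    simp only [hφ, Real.exp_log (div_pos (hkpos _) hmpos)]
    rw [integral_div, ← hmk, div_self hmpos.ne']
  have hφi : Integrable (fun p : A × B => h p * φ p.1) (α.prod β) :=
    hi.mul_bdd (hφm.comp measurable_fst).aestronglyMeasurable (ae_of_all _ fun p => hK p.1)
  have hentk : ent α k = ∫ p, h p * φ p.1 ∂(α.prod β) := by
    rw [integral_prod _ hφi]
    simp only [integral_mul_const]
    have : ∀ x, k x * φ x = k x * Real.log (k x) - k x * Real.log m := fun x => by
      rw [hφ]; dsimp only; rw [Real.log_div (hkpos x).ne' hmpos.ne']; ring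
    calc ent α k = ∫ x, (k x * Real.log (k x) - k x * Real.log m) ∂α := by
          rw [integral_sub hkl (hki.mul_const _), integral_mul_const, ent, ← hmk]
      _ = _ := integral_congr_ae (ae_of_all _ fun x => (this x).symm)
  rw [hentk, integral_prod_symm _ hφi]
  refine integral_mono hφi.integral_prod_right ?_ fun y => ?_
  · exact integrable_ent_right β α (h := fun p => h p.swap) (hh.comp measurable_swap)
      (fun p => hab _)
  · exact integral_mul_le_ent α (hh.comp measurable_prodMk_right) ha (fun x => hab _) hφm hK hφ1

theorem ofReal_ent_prod_le {h : A × B → ℝ} (hh : Measurable h) {a b : ℝ} (ha : 0 < a)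
    (hab : ∀ p, h p ∈ Set.Icc a b) :
    ENNReal.ofReal (ent (α.prod β) h) ≤ ∫⁻ x, ENNReal.ofReal (ent β fun y => h (x, y)) ∂α +
      ∫⁻ y, ENNReal.ofReal (ent α fun x => h (x, y)) ∂β := by
  have h1 : ∀ x, 0 ≤ ent β fun y => h (x, y) := fun x =>
    ent_nonneg β (hh.comp measurable_prodMk_left) ha fun y => hab _
  have h2 : ∀ y, 0 ≤ ent α fun x => h (x, y) := fun y =>
    ent_nonneg α (hh.comp measurable_prodMk_right) ha fun x => hab _
  have hi : Integrable (fun y => ent α fun x => h (x, y)) β :=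
    integrable_ent_right β α (h := fun p => h p.swap) (hh.comp measurable_swap) (fun p => hab _)
  rw [← ofReal_integral_eq_lintegral_ofReal (integrable_ent_right α β hh hab) (ae_of_all _ h1),
    ← ofReal_integral_eq_lintegral_ofReal hi (ae_of_all _ h2),
    ← ENNReal.ofReal_add (integral_nonneg h1) (integral_nonneg h2)]
  exact ENNReal.ofReal_le_ofReal (ent_prod_le α β hh ha hab)

end Product

variable {X : Type*} [MeasurableSpace X] (μ : Measure X) [IsProbabilityMeasure μ]

theorem ent_comp_measurePreserving {A B : Type*} [MeasurableSpace A] [MeasurableSpace B]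
    {α : Measure A} {β : Measure B} (e : A ≃ᵐ B) (he : MeasurePreserving e α β) (g : B → ℝ) :
    ent α (fun x => g (e x)) = ent β g := by
  simp only [ent]
  rw [he.integral_comp' g, he.integral_comp' fun x => g x * Real.log (g x)]

theorem measurable_ent_update {n : ℕ} {g : (Fin n → X) → ℝ} (hg : Measurable g) (i : Fin n) :
    Measurable fun x : Fin n → X => ent μ fun z => g (Function.update x i z) :=
  measurable_ent_right μ (h := fun p : (Fin n → X) × X => g (Function.update p.1 i p.2))
    (hg.comp measurable_update')

/-- Tensorization of the entropy. -/
theorem ofReal_ent_pi_le {a b : ℝ} (ha : 0 < a) (n : ℕ) (g : (Fin n → X) → ℝ)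
    (hg : Measurable g) (hab : ∀ x, g x ∈ Set.Icc a b) :
    ENNReal.ofReal (ent (Measure.pi fun _ : Fin n => μ) g) ≤
      ∑ i, ∫⁻ x, ENNReal.ofReal (ent μ fun z => g (Function.update x i z))
        ∂(Measure.pi fun _ : Fin n => μ) := by
  induction n with
  | zero =>
    have : ent (Measure.pi fun _ : Fin 0 => μ) g = 0 := by
      simp [ent, Measure.pi_of_empty _ (default : Fin 0 → X)]
    simp [this]
  | succ n ih =>
    have hmp := (measurePreserving_piFinSuccAbove (fun _ : Fin (n + 1) => μ) 0).symm
    set e := (MeasurableEquiv.piFinSuccAbove (fun _ : Fin (n + 1) => X) 0).symm with he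
    have hecons : ∀ p : X × (Fin n → X), e p = Fin.cons p.1 p.2 := fun p => by
      simp [he, MeasurableEquiv.piFinSuccAbove_symm_apply]
      rfl
    have hm : Measurable fun p : X × (Fin n → X) => (Fin.cons p.1 p.2 : Fin (n + 1) → X) := by
      simpa only [← hecons] using e.measurable
    have hlint : ∀ F : (Fin (n + 1) → X) → ℝ≥0∞, Measurable F →
        ∫⁻ x, F x ∂(Measure.pi fun _ : Fin (n + 1) => μ) =
        ∫⁻ z, ∫⁻ y : Fin n → X, F (Fin.cons z y) ∂(Measure.pi fun _ : Fin n => μ) ∂μ := by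
      intro F hF
      rw [← hmp.lintegral_comp hF]
      simp only [hecons]
      exact lintegral_prod (fun p : X × (Fin n → X) => F (Fin.cons p.1 p.2))
        (hF.comp hm).aemeasurable
    have hF : ∀ i, Measurable fun x : Fin (n + 1) → X =>
        ENNReal.ofReal (ent μ fun z => g (Function.update x i z)) := fun i =>
      (measurable_ent_update μ hg i).ennreal_ofReal
    rw [← ent_comp_measurePreserving e hmp]
    refine (ofReal_ent_prod_le μ _ (hg.comp e.measurable) ha fun p => hab _).trans ?_
    rw [Fin.sum_univ_succ, add_comm]
    refine add_le_add ?_ ?_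
    · rw [hlint _ (hF 0)]
      simp [hecons]
    · calc _ ≤ ∫⁻ z, ∑ i : Fin n, ∫⁻ y : Fin n → X, ENNReal.ofReal
            (ent μ fun w => g (Fin.cons z (Function.update y i w)))
              ∂(Measure.pi fun _ : Fin n => μ) ∂μ := by
            refine lintegral_mono fun z => ?_
            simp only [Function.comp_apply, hecons]
            exact ih (fun y => g (Fin.cons z y)) (hg.comp (hm.comp measurable_prodMk_left))
              fun y => hab _
        _ = _ := by
            simp only [Fin.cons_update]
            rw [lintegral_finsetSum]
            · exact Finset.sum_congr rfl fun i _ => (hlint _ (hF i.succ)).symm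
            · intro i _
              exact ((hF i.succ).comp hm).lintegral_prod_right'

end Entropy

/-! ### Herbst's argument. -/

section Herbst

open ProbabilityTheory

variable {Ω : Type*} [MeasurableSpace Ω] (P : Measure Ω) [IsProbabilityMeasure P]

/-- **Herbst's argument.** -/
theorem cgf_le_of_ent_exp_le {G : Ω → ℝ} (hG : Measurable G) {B κ : ℝ} (hB : ∀ x, |G x| ≤ B)
    (hent : ∀ s, 0 < s → ent P (fun x => Real.exp (s * G x)) ≤ κ * s ^ 2 * mgf G P s)
    {s : ℝ} (hs : 0 < s) : cgf G P s ≤ s * P[G] + κ * s ^ 2 := by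
  have hexp : ∀ t, Integrable (fun x => Real.exp (t * G x)) P := fun t =>
    integrable_exp_mul_of_mem_Icc hG.aemeasurable (ae_of_all _ fun x => abs_le.1 (hB x))
  have huniv : interior (integrableExpSet G P) = Set.univ := by
    have : integrableExpSet G P = Set.univ := Set.eq_univ_of_forall hexp
    rw [this, interior_univ]
  have hd : ∀ t, HasDerivAt (cgf G P) (deriv (cgf G P) t) t := fun t =>
    (analyticAt_cgf (by rw [huniv]; trivial)).differentiableAt.hasDerivAt
  have hmpos : ∀ t, 0 < mgf G P t := fun t => mgf_pos (hexp t)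
  have hφd : ∀ t, 0 < t → HasDerivAt (fun t => cgf G P t / t - κ * t)
      ((deriv (cgf G P) t * t - cgf G P t * 1) / t ^ 2 - κ * 1) t := fun t ht =>
    ((hd t).div (hasDerivAt_id t) ht.ne').sub ((hasDerivAt_id t).const_mul κ)
  -- Since `Ent(exp(tG)) = t m'(t) - m(t) log m(t)` for the moment generating function `m`, the
  -- entropy hypothesis says precisely that this function has nonpositive derivative. Its limit at
  -- `0+` is the mean of `G`.
  have hanti : AntitoneOn (fun t => cgf G P t / t - κ * t) (Set.Ioi 0) := by
    refine antitoneOn_of_deriv_nonpos (convex_Ioi 0)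
      (fun t ht => (hφd t ht).continuousAt.continuousWithinAt) ?_ ?_
    · rw [interior_Ioi]
      exact fun t ht => (hφd t ht).differentiableAt.differentiableWithinAt
    · rw [interior_Ioi]
      intro t ht
      have ht' : (0 : ℝ) < t := ht
      rw [(hφd t ht).deriv, deriv_cgf (by rw [huniv]; trivial)]
      have h1 := hent t ht
      have h2 : ent P (fun x => Real.exp (t * G x)) =
          t * P[fun x => G x * Real.exp (t * G x)] - mgf G P t * cgf G P t := by
        rw [ent, cgf, ← integral_const_mul]
        congr 1
        refine integral_congr_ae (ae_of_all _ fun x => ?_)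
        simp only [Real.log_exp]
        ring
      rw [h2] at h1
      have hm := hmpos t
      rw [sub_nonpos, div_le_iff₀ (by positivity), mul_one, mul_one, div_mul_eq_mul_div,
        sub_le_iff_le_add, div_le_iff₀ hm]
      nlinarith
  have hlim : Tendsto (fun t => cgf G P t / t - κ * t) (𝓝[>] 0) (𝓝 P[G]) := by
    have hsub : Set.Ioi (0 : ℝ) ⊆ {0}ᶜ := fun x hx => ne_of_gt hx
    have h1 := (hasDerivAt_iff_tendsto_slope_zero.1 (hd 0)).mono_left (nhdsWithin_mono 0 hsub)
    rw [deriv_cgf_zero (by rw [huniv]; trivial)] at h1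
    have h2 : Tendsto (fun t : ℝ => κ * t) (𝓝[>] 0) (𝓝 0) := by
      have : Tendsto (fun t : ℝ => κ * t) (𝓝 0) (𝓝 (κ * 0)) :=
        (continuous_const_mul κ).tendsto 0
      rw [mul_zero] at this
      exact this.mono_left nhdsWithin_le_nhds
    have h3 := h1.sub h2
    simpa [cgf_zero, div_eq_inv_mul] using h3
  have hle : cgf G P s / s - κ * s ≤ P[G] := by
    refine ge_of_tendsto hlim ?_
    filter_upwards [Ioo_mem_nhdsGT hs] with t ht
    exact hanti ht.1 hs ht.2.le
  rw [sub_le_iff_le_add, div_le_iff₀ hs] at hle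
  linarith

end Herbst

/-! ### Gradient lengths: measurability and chain rule. -/

section Gradient

variable {X : Type*} [MetricSpace X]

theorem gradLength_eq_iInf_iSup (f : X → ℝ) (x : X) :
    gradLength f x = ⨅ k : ℕ, ⨆ y ∈ Metric.ball x (1 / (k + 1)) ∩ {x}ᶜ,
      edist (f x) (f y) / edist x y := by
  have h := nhdsWithin_hasBasis (Metric.nhds_basis_ball_inv_nat_succ (x := x)) {x}ᶜ
  rw [gradLength, h.limsup_eq_iInf_iSup]
  simp

/-- The limsup is a countable infimum over radii of uncountable suprema over `y`. Each supremum is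
lower semicontinuous in `x`: for a fixed competitor `y` all the conditions are open, so superlevel
sets are unions of open sets. -/
theorem measurable_partialGradLength [MeasurableSpace X] [BorelSpace X]
    [SecondCountableTopology X] {n : ℕ} {f : (Fin n → X) → ℝ} (hf : Continuous f) (i : Fin n) :
    Measurable (partialGradLength f i) := by
  have heq : partialGradLength f i = fun x => ⨅ k : ℕ,
      ⨆ y ∈ Metric.ball (x i) (1 / (k + 1)) ∩ {x i}ᶜ,
        edist (f x) (f (Function.update x i y)) / edist (x i) y := by
    funext x
    rw [partialGradLength, gradLength_eq_iInf_iSup, Function.update_eq_self]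
  rw [heq]
  refine Measurable.iInf fun k => measurable_of_Ioi fun a => ?_
  rcases eq_or_ne a ⊤ with rfl | ha
  · simp
  refine IsOpen.measurableSet ?_
  have : (fun x : Fin n → X => ⨆ y ∈ Metric.ball (x i) (1 / (k + 1)) ∩ {x i}ᶜ,
      edist (f x) (f (Function.update x i y)) / edist (x i) y) ⁻¹' Set.Ioi a =
      ⋃ y : X, {x | dist y (x i) < 1 / (k + 1)} ∩ ({x | y ≠ x i} ∩
        {x | a * edist (x i) y < edist (f x) (f (Function.update x i y))}) := by
    ext x
    simp only [Set.mem_preimage, Set.mem_Ioi, lt_iSup_iff, Set.mem_iUnion, Set.mem_inter_iff,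
      Metric.mem_ball, Set.mem_compl_iff, Set.mem_singleton_iff, exists_prop, Set.mem_ofPred_eq,
      ne_eq, and_assoc]
    refine exists_congr fun y => and_congr_right fun _ => and_congr_right fun hy => ?_
    rw [ENNReal.lt_div_iff_mul_lt (Or.inl (by simpa [eq_comm] using hy))
      (Or.inl (edist_ne_top _ _))]
  rw [this]
  refine isOpen_iUnion fun y => ?_
  refine (isOpen_lt (by fun_prop) (by fun_prop)).inter (IsOpen.inter ?_ (isOpen_lt ?_ ?_))
  · exact isOpen_ne_fun (by fun_prop) (by fun_prop)
  · exact (ENNReal.continuous_const_mul ha).comp (by fun_prop)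
  · have : Continuous fun x : Fin n → X => f (Function.update x i y) := by fun_prop
    fun_prop

theorem gradLength_le_of_lipschitzWith {f : X → ℝ} {K : NNReal} (hf : LipschitzWith K f) (x : X) :
    gradLength f x ≤ K := by
  refine limsup_le_of_le (by isBoundedDefault) (Eventually.of_forall fun y => ?_)
  exact ENNReal.div_le_of_le_mul (hf x y)

theorem gradLength_ne_top {f : X → ℝ} (hf : LocallyLipschitz f) (x : X) :
    gradLength f x ≠ ⊤ := by
  obtain ⟨K, t, ht, hK⟩ := hf x
  refine ne_top_of_le_ne_top (ENNReal.coe_ne_top (r := K))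
    (limsup_le_of_le (by isBoundedDefault) ?_)
  filter_upwards [nhdsWithin_le_nhds ht] with y hy
  exact ENNReal.div_le_of_le_mul (hK (mem_of_mem_nhds ht) hy)

theorem gradLength_comp_le_of_lipschitzWith_one {f : X → ℝ} {φ : ℝ → ℝ} (hφ : LipschitzWith 1 φ)
    (x : X) : gradLength (fun y => φ (f y)) x ≤ gradLength f x := by
  refine limsup_le_limsup (Eventually.of_forall fun y => ?_)
  exact ENNReal.div_le_div_right (by simpa using hφ (f x) (f y)) _

theorem gradLength_comp_le {f : X → ℝ} (hf : LocallyLipschitz f) {x : X} {φ : ℝ → ℝ} {φ' : ℝ}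
    (hφ : HasDerivAt φ φ' (f x)) :
    gradLength (fun y => φ (f y)) x ≤ ENNReal.ofReal |φ'| * gradLength f x := by
  have key : ∀ ε : ℝ, 0 < ε →
      gradLength (fun y => φ (f y)) x ≤ ENNReal.ofReal (|φ'| + ε) * gradLength f x := by
    intro ε hε
    rw [gradLength, gradLength, ← ENNReal.limsup_const_mul_of_ne_top ENNReal.ofReal_ne_top]
    refine limsup_le_limsup ?_
    have h1 := (hasDerivAt_iff_isLittleO.1 hφ).def hε
    have h2 := (hf.continuous.tendsto x).mono_left (nhdsWithin_le_nhds (s := {x}ᶜ))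
    filter_upwards [h2.eventually h1] with y hy
    rw [← mul_div_assoc]
    gcongr
    rw [edist_dist, edist_dist, ← ENNReal.ofReal_mul (by positivity)]
    refine ENNReal.ofReal_le_ofReal ?_
    rw [dist_comm, dist_comm (f x), Real.dist_eq, Real.dist_eq]
    simp only [Real.norm_eq_abs, smul_eq_mul] at hy
    calc |φ (f y) - φ (f x)|
        = |(φ (f y) - φ (f x) - (f y - f x) * φ') + (f y - f x) * φ'| := by ring_nf
      _ ≤ ε * |f y - f x| + |f y - f x| * |φ'| := by
          refine (abs_add_le _ _).trans (add_le_add hy (abs_mul _ _).le)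
      _ = _ := by ring
  -- Local Lipschitz continuity enters here: the gradient length is finite, so the slack `ε`
  -- vanishes in the product.
  have hlim : Tendsto (fun ε : ℝ => ENNReal.ofReal (|φ'| + ε) * gradLength f x) (𝓝[>] 0)
      (𝓝 (ENNReal.ofReal (|φ'| + 0) * gradLength f x)) := by
    refine ENNReal.Tendsto.mul_const ?_ (Or.inr (gradLength_ne_top hf x))
    refine (ENNReal.continuous_ofReal.comp (by fun_prop :
      Continuous fun ε : ℝ => |φ'| + ε)).tendsto 0 |>.mono_left nhdsWithin_le_nhds
  rw [add_zero] at hlim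
  exact ge_of_tendsto hlim (eventually_mem_nhdsWithin.mono fun ε hε => key ε hε)

theorem gradLength_exp_le {f : X → ℝ} (hf : LocallyLipschitz f) (x : X) {s : ℝ} (hs : 0 < s) :
    gradLength (fun y => Real.exp (s / 2 * f y)) x ^ 2 ≤
      ENNReal.ofReal (s ^ 2 / 4) * ENNReal.ofReal (Real.exp (s * f x)) * gradLength f x ^ 2 := by
  have h : HasDerivAt (fun u => Real.exp (s / 2 * u)) (Real.exp (s / 2 * f x) * (s / 2 * 1))
      (f x) := ((hasDerivAt_id _).const_mul _).exp
  have h2 := pow_le_pow_left' (gradLength_comp_le hf h) 2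
  refine h2.trans_eq ?_
  rw [mul_pow, ← ENNReal.ofReal_mul (by positivity), ← ENNReal.ofReal_pow (abs_nonneg _), sq_abs]
  congr 2
  have : Real.exp (s * f x) = Real.exp (s / 2 * f x) ^ 2 := by
    rw [← Real.exp_nat_mul]; congr 1; push_cast; ring
  rw [this]; ring

theorem locallyLipschitz_exp {f : X → ℝ} (hf : LocallyLipschitz f) (c : ℝ) :
    LocallyLipschitz fun y => Real.exp (c * f y) := by
  have h : ContDiff ℝ 1 fun u : ℝ => Real.exp (c * u) := by fun_prop
  exact h.locallyLipschitz.comp hf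

end Gradient

/-- Resampling one coordinate from `μ` preserves the product law. -/
theorem lintegral_lintegral_update {X : Type*} [MeasurableSpace X] {μ : Measure X}
    [IsProbabilityMeasure μ] {n : ℕ} (i : Fin n) {F : (Fin n → X) → ℝ≥0∞}
    (hF : Measurable F) :
    ∫⁻ x, ∫⁻ z, F (Function.update x i z) ∂μ ∂(Measure.pi fun _ : Fin n => μ) =
      ∫⁻ x, F x ∂(Measure.pi fun _ : Fin n => μ) := by
  have hm : Measurable fun x : Fin n → X => ∫⁻ z, F (Function.update x i z) ∂μ :=
    (hF.comp (measurable_update' (a := i))).lintegral_prod_right'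
      (f := fun p : (Fin n → X) × X => F (Function.update p.1 i p.2))
  refine lintegral_eq_of_lmarginal_eq {i} hm hF ?_
  simp only [lmarginal_singleton, Function.update_idem]
  simp

/-! ### From the logarithmic Sobolev inequality to Laplace bounds. -/

section LogSobolev

open ProbabilityTheory

variable {X : Type*} [MetricSpace X] [MeasurableSpace X]
  {μ : Measure X} [IsProbabilityMeasure μ] {C : ℝ}

/-- Apply `LSI(C)` to `exp(s f / 2)`, whose square is `exp(s f)`; the half in the exponent produces
`s² / 4`. -/
theorem LogSobolev.ofReal_ent_exp_le [OpensMeasurableSpace X] (h : LogSobolev μ C) {f : X → ℝ}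
    (hf : LocallyLipschitz f) {B : ℝ} (hB : ∀ x, |f x| ≤ B) {s : ℝ} (hs : 0 < s) :
    ENNReal.ofReal (ent μ fun x => Real.exp (s * f x)) ≤
      ENNReal.ofReal C * ∫⁻ x, ENNReal.ofReal (s ^ 2 / 4) *
        ENNReal.ofReal (Real.exp (s * f x)) * gradLength f x ^ 2 ∂μ := by
  have hm : Measurable f := hf.continuous.measurable
  have hsq : ∀ x, Real.exp (s / 2 * f x) ^ 2 = Real.exp (s * f x) := fun x => by
    rw [← Real.exp_nat_mul]; congr 1; push_cast; ring
  have h1 := h (fun x => Real.exp (s / 2 * f x)) (locallyLipschitz_exp hf _)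
  simp only [hsq] at h1
  refine (h1 ?_ ?_).trans ?_
  · exact integrable_comp_of_mem_Icc μ hm (fun x => abs_le.1 (hB x))
      (φ := fun u => Real.exp (s * u)) (by fun_prop) (by fun_prop)
  · simp only [Real.log_exp]
    exact integrable_comp_of_mem_Icc μ hm (fun x => abs_le.1 (hB x))
      (φ := fun u => Real.exp (s * u) * (s * u)) (by fun_prop) (by fun_prop)
  · gcongr with x
    exact gradLength_exp_le hf x hs

variable [BorelSpace X]

/-- The one-point version, used to obtain moments; there the gradient bound holds everywhere. -/
theorem LogSobolev.cgf_le (h : LogSobolev μ C) (hC : 0 < C) {f : X → ℝ} (hf : LipschitzWith 1 f)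
    {B : ℝ} (hB : ∀ x, |f x| ≤ B) {s : ℝ} (hs : 0 < s) :
    cgf f μ s ≤ s * ∫ x, f x ∂μ + C / 4 * s ^ 2 := by
  have hm : Measurable f := hf.continuous.measurable
  refine cgf_le_of_ent_exp_le _ hm hB (fun t ht => ?_) hs
  have hexp : Integrable (fun x => Real.exp (t * f x)) μ :=
    integrable_comp_of_mem_Icc μ hm (fun x => abs_le.1 (hB x))
      (φ := fun u => Real.exp (t * u)) (by fun_prop) (by fun_prop)
  have hmgf : 0 ≤ mgf f μ t := mgf_nonneg
  refine (ENNReal.ofReal_le_ofReal_iff (by positivity)).1 ?_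
  calc ENNReal.ofReal (ent μ fun x => Real.exp (t * f x))
      ≤ ENNReal.ofReal C * ∫⁻ x, ENNReal.ofReal (t ^ 2 / 4) *
        ENNReal.ofReal (Real.exp (t * f x)) * gradLength f x ^ 2 ∂μ :=
        h.ofReal_ent_exp_le hf.locallyLipschitz hB ht
    _ ≤ ENNReal.ofReal C * ∫⁻ x, ENNReal.ofReal (t ^ 2 / 4) *
        ENNReal.ofReal (Real.exp (t * f x)) * 1 ^ 2 ∂μ := by
        gcongr with x
        exact_mod_cast gradLength_le_of_lipschitzWith hf x
    _ = _ := by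
        simp only [one_pow, mul_one]
        rw [lintegral_const_mul' _ _ ENNReal.ofReal_ne_top,
          ← ofReal_integral_eq_lintegral_ofReal hexp (ae_of_all _ fun x => (Real.exp_pos _).le),
          ← ENNReal.ofReal_mul (by positivity), ← ENNReal.ofReal_mul hC.le, mgf]
        congr 1; ring

variable [SecondCountableTopology X]

/-- The logarithmic Sobolev inequality for `μ^n`, applied to an exponential. -/
theorem LogSobolev.ent_exp_pi_le (h : LogSobolev μ C) (hC : 0 < C) {n : ℕ}
    {f : (Fin n → X) → ℝ} (hf : LocallyLipschitz f) {B : ℝ} (hB : ∀ x, |f x| ≤ B) {σ : ℝ}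
    (hσ : 0 ≤ σ)
    (hgrad : ∀ᵐ x ∂(Measure.pi fun _ : Fin n => μ),
      ∑ i, partialGradLength f i x ^ 2 ≤ ENNReal.ofReal σ) {s : ℝ} (hs : 0 < s) :
    ent (Measure.pi fun _ : Fin n => μ) (fun x => Real.exp (s * f x)) ≤
      C * σ / 4 * s ^ 2 * mgf f (Measure.pi fun _ : Fin n => μ) s := by
  set P := Measure.pi fun _ : Fin n => μ
  have hm : Measurable f := hf.continuous.measurable
  have hexp : Integrable (fun x => Real.exp (s * f x)) P :=
    integrable_comp_of_mem_Icc P hm (fun x => abs_le.1 (hB x))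
      (φ := fun u => Real.exp (s * u)) (by fun_prop) (by fun_prop)
  set Φ : Fin n → (Fin n → X) → ℝ≥0∞ := fun i x => ENNReal.ofReal (s ^ 2 / 4) *
    ENNReal.ofReal (Real.exp (s * f x)) * partialGradLength f i x ^ 2 with hΦ
  have hΦm : ∀ i, Measurable (Φ i) := fun i => by
    have := measurable_partialGradLength hf.continuous i
    fun_prop
  have key : ENNReal.ofReal (ent P fun x => Real.exp (s * f x)) ≤
      ENNReal.ofReal (C * σ / 4 * s ^ 2 * mgf f P s) := by
    calc ENNReal.ofReal (ent P fun x => Real.exp (s * f x))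
        ≤ ∑ i, ∫⁻ x, ENNReal.ofReal (ent μ fun z => Real.exp (s * f (Function.update x i z))) ∂P :=
          ofReal_ent_pi_le μ (Real.exp_pos (s * -B)) n _ (by fun_prop) fun x =>
            ⟨by gcongr; exact (abs_le.1 (hB x)).1,
              Real.exp_le_exp.2 (mul_le_mul_of_nonneg_left (abs_le.1 (hB x)).2 hs.le)⟩
      _ ≤ ∑ i, ∫⁻ x, ENNReal.ofReal C * ∫⁻ z, Φ i (Function.update x i z) ∂μ ∂P := by
          refine Finset.sum_le_sum fun i _ => lintegral_mono fun x => ?_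
          have hl : LocallyLipschitz fun z => f (Function.update x i z) :=
            hf.comp ((LipschitzWith.of_edist_le fun y z => by
              rw [edist_pi_def]
              refine Finset.sup_le fun j _ => ?_
              rcases eq_or_ne j i with rfl | hj <;> simp [*]).locallyLipschitz)
          refine (h.ofReal_ent_exp_le hl (fun z => hB _) hs).trans_eq ?_
          simp [hΦ, partialGradLength]
      _ = ∑ i, ENNReal.ofReal C * ∫⁻ x, Φ i x ∂P := by
          refine Finset.sum_congr rfl fun i _ => ?_
          rw [lintegral_const_mul' _ _ ENNReal.ofReal_ne_top,
            lintegral_lintegral_update i (hΦm i)]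
      _ = ENNReal.ofReal C * ∫⁻ x, ∑ i, Φ i x ∂P := by
          rw [← Finset.mul_sum, lintegral_finsetSum _ fun i _ => hΦm i]
      -- The coordinates are recombined under a single integral, so an almost everywhere bound on
      -- the sum of squares suffices.
      _ ≤ ENNReal.ofReal C * ∫⁻ x, ENNReal.ofReal (s ^ 2 / 4 * σ) *
            ENNReal.ofReal (Real.exp (s * f x)) ∂P := by
          refine mul_le_mul_right (lintegral_mono_ae (hgrad.mono fun x hx => ?_)) _
          rw [hΦ]
          dsimp only
          rw [← Finset.mul_sum, ENNReal.ofReal_mul (by positivity)]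
          calc _ ≤ ENNReal.ofReal (s ^ 2 / 4) * ENNReal.ofReal (Real.exp (s * f x)) *
                ENNReal.ofReal σ := by gcongr
            _ = _ := by ring
      _ = ENNReal.ofReal (C * σ / 4 * s ^ 2 * mgf f P s) := by
          rw [lintegral_const_mul' _ _ ENNReal.ofReal_ne_top,
            ← ofReal_integral_eq_lintegral_ofReal hexp (ae_of_all _ fun x => (Real.exp_pos _).le),
            ← ENNReal.ofReal_mul (by positivity), ← ENNReal.ofReal_mul hC.le, mgf]
          congr 1; ring
  refine (ENNReal.ofReal_le_ofReal_iff ?_).1 key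
  have : 0 ≤ mgf f P s := mgf_nonneg
  positivity

theorem LogSobolev.cgf_pi_le (h : LogSobolev μ C) (hC : 0 < C) {n : ℕ}
    {f : (Fin n → X) → ℝ} (hf : LocallyLipschitz f) {B : ℝ} (hB : ∀ x, |f x| ≤ B) {σ : ℝ}
    (hσ : 0 ≤ σ)
    (hgrad : ∀ᵐ x ∂(Measure.pi fun _ : Fin n => μ),
      ∑ i, partialGradLength f i x ^ 2 ≤ ENNReal.ofReal σ) {s : ℝ} (hs : 0 < s) :
    cgf f (Measure.pi fun _ : Fin n => μ) s ≤
      s * ∫ x, f x ∂(Measure.pi fun _ : Fin n => μ) + C * σ / 4 * s ^ 2 :=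
  cgf_le_of_ent_exp_le _ hf.continuous.measurable hB
    (fun _ ht => h.ent_exp_pi_le hC hf hB hσ hgrad ht) hs

end LogSobolev

/-! ### Relative entropy: duality and products. -/

section RelativeEntropy

open ProbabilityTheory

/-- The relative entropy of `Q` with respect to the tilted measure `exp(f) P / ∫ exp(f) dP` is
nonnegative; expanding it gives the inequality. -/
theorem integral_le_klDiv_add_log {Ω : Type*} [MeasurableSpace Ω] (Q P : Measure Ω)
    [IsProbabilityMeasure Q] [IsProbabilityMeasure P] (hQP : klDiv Q P ≠ ⊤) {f : Ω → ℝ}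
    (hf : Measurable f) {B : ℝ} (hB : ∀ x, |f x| ≤ B) :
    ∫ x, f x ∂Q ≤ (klDiv Q P).toReal + Real.log (∫ x, Real.exp (f x) ∂P) := by
  obtain ⟨hac, hllr⟩ := klDiv_ne_top_iff.1 hQP
  have hfQ : Integrable f Q := Integrable.of_bound hf.aestronglyMeasurable B (ae_of_all _ hB)
  have hfP : Integrable (fun x => Real.exp (f x)) P :=
    integrable_comp_of_mem_Icc P hf (fun x => abs_le.1 (hB x)) Real.measurable_exp
      Real.continuous_exp.continuousOn
  have : IsProbabilityMeasure (P.tilted f) := isProbabilityMeasure_tilted hfP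
  have h1 := integral_llr_tilted_right hac hfQ hfP hllr
  have h2 := integral_llr_add_sub_measure_univ_nonneg
    (hac.trans (absolutelyContinuous_tilted hfP)) (integrable_llr_tilted_right hac hfQ hllr hfP)
  rw [h1] at h2
  simp only [probReal_univ] at h2
  rw [toReal_klDiv_of_measure_eq hac (by simp)]
  linarith

/-- The chain rule leaves the divergence of `α ⊗ β` from `α ⊗ β'`. After a swap, data processing
makes `α` a common constant kernel, which contributes nothing. -/
theorem klDiv_prod_le {A B : Type*} [MeasurableSpace A] [MeasurableSpace B] (α α' : Measure A)
    (β β' : Measure B) [IsProbabilityMeasure α] [IsProbabilityMeasure α']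
    [IsProbabilityMeasure β] [IsProbabilityMeasure β'] :
    klDiv (α.prod β) (α'.prod β') ≤ klDiv α α' + klDiv β β' := by
  have h1 := klDiv_compProd_eq_add α α' (Kernel.const A β) (Kernel.const A β')
  simp only [Measure.compProd_const] at h1
  rw [h1]
  refine add_le_add le_rfl ?_
  have h2 := klDiv_map_le (β.prod α) (β'.prod α) measurable_swap
  rw [Measure.prod_swap, Measure.prod_swap] at h2
  refine h2.trans_eq ?_
  have h3 := klDiv_compProd_left β β' (Kernel.const B α)
  simpa only [Measure.compProd_const] using h3

theorem klDiv_pi_le {X : Type*} [MeasurableSpace X] (ν μ : Measure X) [IsProbabilityMeasure ν]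
    [IsProbabilityMeasure μ] (n : ℕ) :
    klDiv (Measure.pi fun _ : Fin n => ν) (Measure.pi fun _ : Fin n => μ) ≤ n * klDiv ν μ := by
  induction n with
  | zero => simp [Measure.pi_of_empty _ (default : Fin 0 → X), klDiv_self]
  | succ n ih =>
    have h1 := (measurePreserving_piFinSuccAbove (fun _ : Fin (n + 1) => ν) 0).symm
    have h2 := (measurePreserving_piFinSuccAbove (fun _ : Fin (n + 1) => μ) 0).symm
    rw [← h1.map_eq, ← h2.map_eq]
    refine (klDiv_map_le _ _ (MeasurableEquiv.measurable _)).trans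
      ((klDiv_prod_le _ _ _ _).trans ?_)
    push_cast
    rw [add_mul, one_mul, add_comm]
    exact add_le_add ih le_rfl

end RelativeEntropy

/-! ### Gaussian moments and finiteness of second moments. -/

section Moments

open ProbabilityTheory

/-- Fatou removes the truncation that Herbst's argument and the duality require. -/
theorem lintegral_le_of_forall_min {Ω : Type*} [MeasurableSpace Ω] {P : Measure Ω} {g : Ω → ℝ}
    (hg : Measurable g) {φ : ℝ → ℝ} (hφ : Measurable φ) {A : ℝ≥0∞}
    (h : ∀ k : ℕ, ∫⁻ x, ENNReal.ofReal (φ (min (g x) k)) ∂P ≤ A) :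
    ∫⁻ x, ENNReal.ofReal (φ (g x)) ∂P ≤ A := by
  have hlim : ∀ x, liminf (fun k : ℕ => ENNReal.ofReal (φ (min (g x) k))) atTop =
      ENNReal.ofReal (φ (g x)) := fun x => by
    refine Tendsto.liminf_eq (tendsto_const_nhds.congr' ?_)
    filter_upwards [eventually_ge_atTop ⌈g x⌉₊] with k hk
    rw [min_eq_left ((Nat.le_ceil _).trans (by exact_mod_cast hk))]
  simp_rw [← hlim]
  refine (lintegral_liminf_le fun k => by fun_prop).trans ?_
  exact liminf_le_of_frequently_le' (Frequently.of_forall h)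

variable {X : Type*} [MetricSpace X] [MeasurableSpace X] [BorelSpace X]
  {μ : Measure X} [IsProbabilityMeasure μ] {C : ℝ}

theorem LogSobolev.exists_lintegral_exp_mul_dist_le (h : LogSobolev μ C) (hC : 0 < C) (x₀ : X) :
    ∃ a : ℝ, ∀ s, 0 < s → ∫⁻ x, ENNReal.ofReal (Real.exp (s * dist x₀ x)) ∂μ ≤
      ENNReal.ofReal (Real.exp (s * a + C / 4 * s ^ 2)) := by
  obtain ⟨m, hm⟩ : ∃ m : ℕ, (1 / 2 : ℝ≥0∞) < μ (Metric.closedBall x₀ m) := by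
    have hmono : Monotone fun m : ℕ => Metric.closedBall x₀ (m : ℝ) := fun i j hij =>
      Metric.closedBall_subset_closedBall (by exact_mod_cast hij)
    have hlim := tendsto_measure_iUnion_atTop (μ := μ) hmono
    rw [Metric.iUnion_closedBall_nat, measure_univ] at hlim
    exact (hlim.eventually_const_lt (by norm_num)).exists
  have hm' : (1 / 2 : ℝ) ≤ μ.real (Metric.closedBall x₀ m) := by
    have := ENNReal.toReal_mono (measure_ne_top _ _) hm.le
    simpa [Measure.real] using this
  set f : ℕ → X → ℝ := fun k x => min (dist x₀ x) k with hf
  have hfl : ∀ k, LipschitzWith 1 (f k) := fun k => (LipschitzWith.dist_right x₀).min_const _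
  have hf0 : ∀ k x, 0 ≤ f k x := fun k x => le_min dist_nonneg (Nat.cast_nonneg k)
  have hfB : ∀ k x, |f k x| ≤ k := fun k x => by
    rw [abs_of_nonneg (hf0 k x)]; exact min_le_right _ _
  -- No moment is known yet, so the truncated means must be bounded uniformly in `k`. The Laplace
  -- bound for `-f k` at parameter `1` bounds `log ∫ exp(-f k)` above by `C / 4` minus the mean; the
  -- ball of mass above `1/2` bounds it below by `-m - log 2`.
  have hmean : ∀ k, ∫ x, f k x ∂μ ≤ m + Real.log 2 + C / 4 := by
    intro k
    have h1 := h.cgf_le hC (f := fun x => - f k x) (hfl k).neg (B := k)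
      (fun x => by rw [abs_neg]; exact hfB k x) one_pos
    have hexp : Integrable (fun x => Real.exp (1 * -f k x)) μ :=
      integrable_comp_of_mem_Icc μ (hfl k).continuous.measurable (fun x => abs_le.1 (hfB k x))
        (φ := fun u => Real.exp (1 * -u)) (by fun_prop) (by fun_prop)
    have h2 : Real.exp (-m) * (1 / 2) ≤ mgf (fun x => -f k x) μ 1 := by
      calc Real.exp (-m) * (1 / 2) ≤ Real.exp (-m) * μ.real (Metric.closedBall x₀ m) := by gcongr
        _ = ∫ x, (Metric.closedBall x₀ m).indicator (fun _ => Real.exp (-m)) x ∂μ := by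
            rw [integral_indicator_const _ Metric.isClosed_closedBall.measurableSet, smul_eq_mul,
              mul_comm]
        _ ≤ _ := by
            refine integral_mono_of_nonneg (ae_of_all _ fun x =>
              Set.indicator_nonneg (fun _ _ => (Real.exp_pos _).le) x) hexp
              (ae_of_all _ fun x => ?_)
            by_cases hx : x ∈ Metric.closedBall x₀ (m : ℝ)
            · rw [Set.indicator_of_mem hx]
              dsimp only
              rw [one_mul]
              refine Real.exp_le_exp.2 (neg_le_neg ((min_le_left _ _).trans ?_))
              rw [dist_comm]; exact hx
            · rw [Set.indicator_of_notMem hx]; exact (Real.exp_pos _).le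
    have h3 := Real.log_le_log (by positivity) h2
    rw [Real.log_mul (by positivity) (by norm_num), Real.log_exp, one_div, Real.log_inv] at h3
    rw [integral_neg] at h1
    simp only [cgf] at h1
    linarith
  refine ⟨m + Real.log 2 + C / 4, fun s hs => ?_⟩
  refine lintegral_le_of_forall_min (g := fun x => dist x₀ x) (φ := fun u => Real.exp (s * u))
    (by fun_prop) (by fun_prop) fun k => ?_
  have hexp : Integrable (fun x => Real.exp (s * f k x)) μ :=
    integrable_comp_of_mem_Icc μ (hfl k).continuous.measurable (fun x => abs_le.1 (hfB k x))
      (φ := fun u => Real.exp (s * u)) (by fun_prop) (by fun_prop)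
  rw [← ofReal_integral_eq_lintegral_ofReal hexp (ae_of_all _ fun x => (Real.exp_pos _).le)]
  refine ENNReal.ofReal_le_ofReal ?_
  have h1 := h.cgf_le hC (hfl k) (hfB k) hs
  have h2 : mgf (f k) μ s = Real.exp (cgf (f k) μ s) := (exp_cgf hexp).symm
  rw [mgf] at h2
  rw [h2]
  gcongr
  refine h1.trans ?_
  gcongr
  exact hmean k

/-- A logarithmic Sobolev inequality implies a Gaussian moment. -/
theorem LogSobolev.lintegral_exp_mul_dist_sq_lt_top (h : LogSobolev μ C) (hC : 0 < C) (x₀ : X) :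
    ∫⁻ x, ENNReal.ofReal (Real.exp (1 / (2 * C) * dist x₀ x ^ 2)) ∂μ < ⊤ := by
  obtain ⟨a, ha⟩ := h.exists_lintegral_exp_mul_dist_le hC x₀
  -- On the shell `j ≤ dist < j + 1` use the exponential moment with `s = 2 (j + 1) / C`. With `N =
  -- j + 1` the exponent becomes `b N - N² / (2C)`, and completing the square with `K` bounds it by
  -- `K - N`, whence a geometric series.
  set b := 2 * (a + 1) / C with hb
  set K := C * (b + 1) ^ 2 / 2 with hK
  set u : ℕ → ℝ := fun j => 1 / (2 * C) * (j + 1) ^ 2 - 2 / C * (j + 1) * j with hu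
  calc ∫⁻ x, ENNReal.ofReal (Real.exp (1 / (2 * C) * dist x₀ x ^ 2)) ∂μ
      ≤ ∫⁻ x, ∑' j : ℕ, ENNReal.ofReal (Real.exp (u j)) *
          ENNReal.ofReal (Real.exp (2 / C * (j + 1) * dist x₀ x)) ∂μ := by
        refine lintegral_mono fun x => ?_
        refine le_trans ?_ (ENNReal.le_tsum ⌊dist x₀ x⌋₊)
        rw [← ENNReal.ofReal_mul (Real.exp_pos _).le, ← Real.exp_add]
        refine ENNReal.ofReal_le_ofReal (Real.exp_le_exp.2 ?_)
        have h1 := Nat.floor_le (dist_nonneg (x := x₀) (y := x))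
        have h2 := (Nat.lt_floor_add_one (dist x₀ x)).le
        have h3 : 1 / (2 * C) * dist x₀ x ^ 2 ≤ 1 / (2 * C) * ((⌊dist x₀ x⌋₊ : ℝ) + 1) ^ 2 := by
          gcongr
        have h4 : 2 / C * (⌊dist x₀ x⌋₊ + 1) * ⌊dist x₀ x⌋₊ ≤
            2 / C * (⌊dist x₀ x⌋₊ + 1) * dist x₀ x := by gcongr
        simp only [hu]
        linarith
    _ = ∑' j : ℕ, ENNReal.ofReal (Real.exp (u j)) *
          ∫⁻ x, ENNReal.ofReal (Real.exp (2 / C * (j + 1) * dist x₀ x)) ∂μ := by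
        rw [lintegral_tsum fun j => by fun_prop]
        exact tsum_congr fun j => lintegral_const_mul _ (by fun_prop)
    _ ≤ ∑' j : ℕ, ENNReal.ofReal (Real.exp K * Real.exp (-1) ^ j) := by
        refine ENNReal.tsum_le_tsum fun j => ?_
        refine (mul_le_mul_right (ha (2 / C * (j + 1)) (by positivity)) _).trans ?_
        rw [← ENNReal.ofReal_mul (Real.exp_pos _).le, ← Real.exp_add, ← Real.exp_nat_mul,
          ← Real.exp_add]
        refine ENNReal.ofReal_le_ofReal (Real.exp_le_exp.2 ?_)
        have key : 0 ≤ 1 / (2 * C) * ((j + 1 : ℝ) - C * (b + 1)) ^ 2 := by positivity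
        have e1 : u j + (2 / C * (j + 1) * a + C / 4 * (2 / C * (j + 1)) ^ 2) =
            K - (j + 1) - 1 / (2 * C) * ((j + 1 : ℝ) - C * (b + 1)) ^ 2 := by
          simp only [hu, hK, hb]; field_simp; ring
        rw [e1]
        linarith
    _ < ⊤ := by
        rw [← ENNReal.ofReal_tsum_of_nonneg]
        · exact ENNReal.ofReal_lt_top
        · intro j; positivity
        · refine (summable_geometric_of_lt_one (Real.exp_pos _).le ?_).mul_left _
          exact Real.exp_lt_one_iff.2 (by norm_num)

/-- Entropy duality with the test function `dist² / (2C)`, truncated, whose exponential is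
`μ`-integrable. -/
theorem LogSobolev.hasFiniteSecondMoment_of_klDiv_ne_top (h : LogSobolev μ C) (hC : 0 < C)
    {ν : Measure X} [IsProbabilityMeasure ν] (hν : klDiv ν μ ≠ ⊤) : HasFiniteSecondMoment ν := by
  obtain ⟨x₀⟩ : Nonempty X := nonempty_of_isProbabilityMeasure μ
  refine ⟨x₀, ?_⟩
  have hE := h.lintegral_exp_mul_dist_sq_lt_top hC x₀
  set c := 1 / (2 * C) with hc
  have hcpos : 0 < c := by positivity
  have hEi : Integrable (fun x => Real.exp (c * dist x₀ x ^ 2)) μ := by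
    refine (lintegral_ofReal_ne_top_iff_integrable (by fun_prop)
      (ae_of_all _ fun x => (Real.exp_pos _).le)).1 hE.ne

  set A := ((klDiv ν μ).toReal + Real.log (∫ x, Real.exp (c * dist x₀ x ^ 2) ∂μ)) / c
  have key : ∫⁻ x, ENNReal.ofReal (dist x₀ x ^ 2) ∂ν ≤ ENNReal.ofReal A := by
    refine lintegral_le_of_forall_min (g := fun x => dist x₀ x ^ 2) (φ := fun u => u)
      (by fun_prop) (by fun_prop) fun k => ?_
    set f : X → ℝ := fun x => min (dist x₀ x ^ 2) k
    have hfm : Measurable f := by fun_prop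
    have hf0 : ∀ x, 0 ≤ f x := fun x => le_min (sq_nonneg _) (Nat.cast_nonneg k)
    have hfB : ∀ x, |f x| ≤ k := fun x => by
      rw [abs_of_nonneg (hf0 x)]; exact min_le_right _ _
    have hi : Integrable f ν := Integrable.of_bound hfm.aestronglyMeasurable k (ae_of_all _ hfB)
    have hie : Integrable (fun x => Real.exp (c * f x)) μ :=
      integrable_comp_of_mem_Icc μ hfm (fun x => abs_le.1 (hfB x))
        (φ := fun u => Real.exp (c * u)) (by fun_prop) (by fun_prop)
    rw [← ofReal_integral_eq_lintegral_ofReal hi (ae_of_all _ hf0)]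
    refine ENNReal.ofReal_le_ofReal ?_
    rw [le_div_iff₀ hcpos, mul_comm, ← integral_const_mul]
    refine (integral_le_klDiv_add_log ν μ hν (f := fun x => c * f x) (by fun_prop) (B := c * k)
      (fun x => ?_)).trans ?_
    · rw [abs_mul, abs_of_pos hcpos]; gcongr; exact hfB x
    · have h1 : 1 ≤ ∫ x, Real.exp (c * f x) ∂μ := by
        simpa using integral_mono (integrable_const (1 : ℝ)) hie fun x =>
          Real.one_le_exp (mul_nonneg hcpos.le (hf0 x))
      refine add_le_add le_rfl (Real.log_le_log (one_pos.trans_le h1)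
        (integral_mono hie hEi fun x => Real.exp_le_exp.2 ?_))
      exact mul_le_mul_of_nonneg_left (min_le_left _ _) hcpos.le
  refine lt_of_le_of_lt ?_ (key.trans_lt ENNReal.ofReal_lt_top)
  refine lintegral_mono fun x => ?_
  rw [edist_dist, ENNReal.ofReal_pow dist_nonneg]

theorem LogSobolev.hasFiniteSecondMoment (h : LogSobolev μ C) (hC : 0 < C) :
    HasFiniteSecondMoment μ :=
  h.hasFiniteSecondMoment_of_klDiv_ne_top hC (by simp [klDiv_self])

end Moments

/-! ### From `(∗)` and `LSI(C)` to `T₂(C)`. -/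

section Talagrand

open ProbabilityTheory

variable {X : Type*} [MetricSpace X] [MeasurableSpace X]

theorem empiricalDist_nonneg (μ : Measure X) {n : ℕ} (x : Fin n → X) : 0 ≤ empiricalDist μ n x :=
  ENNReal.toReal_nonneg

theorem GradientCondition.ae_sum_min_le {μ : Measure X} (h : GradientCondition μ) {n : ℕ}
    (hn : 0 < n) (w : ℝ) : ∀ᵐ x ∂(Measure.pi fun _ : Fin n => μ),
      ∑ i, partialGradLength (fun x => min (empiricalDist μ n x) w) i x ^ 2 ≤
        ENNReal.ofReal (n : ℝ)⁻¹ := by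
  filter_upwards [h n hn] with x hx
  rw [ENNReal.ofReal_inv_of_pos (by positivity), ENNReal.ofReal_natCast]
  refine le_trans ?_ hx
  gcongr with i
  exact gradLength_comp_le_of_lipschitzWith_one (φ := fun u => min u w)
    (LipschitzWith.id.min_const w) (x i)

variable [BorelSpace X] [SecondCountableTopology X] [StandardBorelSpace X]

theorem tendsto_integral_min_empiricalDist {ν : Measure X} [IsProbabilityMeasure ν]
    (hν : HasFiniteSecondMoment ν) {w : ℝ} (hw : 0 ≤ w) :
    Tendsto (fun n : ℕ => ∫ x, min (empiricalDist ν n x) w ∂(Measure.pi fun _ : Fin n => ν))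
      atTop (𝓝 0) := by
  have h1 : Tendsto (fun n : ℕ => ∫⁻ x, ENNReal.ofReal (min (empiricalDist ν n x) w)
      ∂(Measure.pi fun _ : Fin n => ν)) atTop (𝓝 0) := by
    refine tendsto_of_tendsto_of_tendsto_of_le_of_le' tendsto_const_nhds
      (tendsto_lintegral_wasserstein_empiricalMeasure hν) (Eventually.of_forall fun _ => zero_le)
      ?_
    filter_upwards [eventually_gt_atTop 0] with n hn
    refine lintegral_mono fun x => ?_
    rw [← ofReal_empiricalDist hν hn]
    exact ENNReal.ofReal_le_ofReal (min_le_left _ _)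
  have h2 := (ENNReal.tendsto_toReal ENNReal.zero_ne_top).comp h1
  refine (h2.congr' ?_)
  filter_upwards [eventually_gt_atTop 0] with n hn
  rw [integral_eq_lintegral_of_nonneg_ae]
  · rfl
  · exact ae_of_all _ fun x => le_min (empiricalDist_nonneg _ _) hw
  · have := (lipschitzWith_empiricalDist hν hn).continuous
    exact (by fun_prop : Continuous fun x => min (empiricalDist ν n x) w).aestronglyMeasurable

theorem wasserstein_le_integral_add {μ ν : Measure X} [IsProbabilityMeasure μ]
    [IsProbabilityMeasure ν] (hμ : HasFiniteSecondMoment μ) (hν : HasFiniteSecondMoment ν)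
    {n : ℕ} (hn : 0 < n) (x : Fin n → X) :
    (wasserstein ν μ).toReal ≤ empiricalDist ν n x + empiricalDist μ n x := by
  have := isProbabilityMeasure_empiricalMeasure hn x
  have h1 := wasserstein_triangle ν (empiricalMeasure x) μ
  rw [wasserstein_comm ν (empiricalMeasure x)] at h1
  have f1 := wasserstein_empiricalMeasure_ne_top hν hn x
  have f2 := wasserstein_empiricalMeasure_ne_top hμ hn x
  have h2 := ENNReal.toReal_mono (ENNReal.add_ne_top.2 ⟨f1, f2⟩) h1
  rwa [ENNReal.toReal_add f1 f2] at h2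

/-- The inequality at finite `n`: the Laplace bound under `μⁿ` meets the entropy duality for `νⁿ`.
-/
theorem mul_wasserstein_sub_le {μ ν : Measure X} [IsProbabilityMeasure μ]
    [IsProbabilityMeasure ν] (hgrad : GradientCondition μ) {C : ℝ} (hC : 0 < C)
    (h : LogSobolev μ C) (hμ : HasFiniteSecondMoment μ) (hν : HasFiniteSecondMoment ν)
    (hfin : klDiv ν μ ≠ ⊤) {l : ℝ} (hl : 0 < l) {n : ℕ} (hn : 0 < n) :
    l * ((wasserstein ν μ).toReal - ∫ x, min (empiricalDist ν n x) (wasserstein ν μ).toReal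
        ∂(Measure.pi fun _ : Fin n => ν)) ≤
      (klDiv ν μ).toReal + l * (∫ x, min (empiricalDist μ n x) (wasserstein ν μ).toReal
        ∂(Measure.pi fun _ : Fin n => μ)) + C * l ^ 2 / 4 := by
  set H := (klDiv ν μ).toReal with hH
  set w := (wasserstein ν μ).toReal with hw
  have hw0 : 0 ≤ w := ENNReal.toReal_nonneg
  have hn' : (0 : ℝ) < n := by exact_mod_cast hn
  set P := Measure.pi fun _ : Fin n => μ
  set Q := Measure.pi fun _ : Fin n => ν
  -- Truncation at `w` makes `G` bounded without losing the lower bound: `w ≤ a + b` implies `w -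
  -- min b w ≤ min a w` for `a, b ≥ 0`.
  set G : (Fin n → X) → ℝ := fun x => min (empiricalDist μ n x) w with hG
  have hGl : LipschitzWith 1 G := (lipschitzWith_empiricalDist hμ hn).min_const w
  have hG0 : ∀ x, 0 ≤ G x := fun x => le_min (empiricalDist_nonneg _ _) hw0
  have hGB : ∀ x, |G x| ≤ w := fun x => by
    rw [abs_of_nonneg (hG0 x)]; exact min_le_right _ _
  -- At parameter `s = n l` with gradient bound `1/n`, the quadratic term is `n C l² / 4`, of the
  -- same order as the entropy `n H`.
  have hs : 0 < n * l := by positivity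
  have h1 := h.cgf_pi_le hC hGl.locallyLipschitz hGB (inv_nonneg.2 hn'.le)
    (hgrad.ae_sum_min_le hn w) hs
  have hkl : klDiv Q P ≤ n * klDiv ν μ := klDiv_pi_le ν μ n
  have hkltop : (n : ℝ≥0∞) * klDiv ν μ ≠ ⊤ := ENNReal.mul_ne_top (by simp) hfin
  have h2 := integral_le_klDiv_add_log Q P (ne_top_of_le_ne_top hkltop hkl)
    (f := fun x => n * l * G x) (hGl.continuous.measurable.const_mul _) (B := n * l * w)
    (fun x => by rw [abs_mul, abs_of_pos hs]; gcongr; exact hGB x)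
  have h3 : (klDiv Q P).toReal ≤ n * H := by
    refine (ENNReal.toReal_mono hkltop hkl).trans_eq ?_
    rw [ENNReal.toReal_mul, ENNReal.toReal_natCast]
  have hGi : Integrable G Q := Integrable.of_bound hGl.continuous.aestronglyMeasurable w
    (ae_of_all _ hGB)
  have hνl : LipschitzWith 1 fun x => min (empiricalDist ν n x) w :=
    (lipschitzWith_empiricalDist hν hn).min_const w
  have hνi : Integrable (fun x => min (empiricalDist ν n x) w) Q :=
    Integrable.of_bound hνl.continuous.aestronglyMeasurable w (ae_of_all _ fun x => by
      rw [Real.norm_eq_abs, abs_of_nonneg (le_min (empiricalDist_nonneg _ _) hw0)]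
      exact min_le_right _ _)
  have h4 : w - ∫ x, min (empiricalDist ν n x) w ∂Q ≤ ∫ x, G x ∂Q := by
    have : ∫ x, (w - min (empiricalDist ν n x) w) ∂Q ≤ ∫ x, G x ∂Q := by
      refine integral_mono ((integrable_const w).sub hνi) hGi fun x => ?_
      have h5 := wasserstein_le_integral_add hμ hν hn x
      have h6 : 0 ≤ empiricalDist ν n x := empiricalDist_nonneg _ _
      have h7 : 0 ≤ empiricalDist μ n x := empiricalDist_nonneg _ _
      simp only [hG, sub_le_iff_le_add]
      rcases le_total (empiricalDist μ n x) w with h8 | h8 <;>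
      rcases le_total (empiricalDist ν n x) w with h9 | h9 <;>
      simp only [min_eq_left, min_eq_right, h8, h9] <;> linarith
    rw [integral_sub (integrable_const w) hνi] at this
    simpa using this
  rw [integral_const_mul] at h2
  simp only [cgf, mgf] at h1
  have h5 : n * (l * ∫ x, G x ∂Q) ≤
      n * (H + l * (∫ x, G x ∂P) + C * l ^ 2 / 4) := by
    have e : C * (n : ℝ)⁻¹ / 4 * (n * l) ^ 2 = n * (C * l ^ 2 / 4) := by field_simp
    rw [e] at h1
    linarith
  have h6 := le_of_mul_le_mul_left h5 hn'
  exact (mul_le_mul_of_nonneg_left h4 hl.le).trans h6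

theorem talagrandT2_of_gradientCondition {μ : Measure X} [IsProbabilityMeasure μ]
    (hgrad : GradientCondition μ) {C : ℝ} (hC : 0 < C) (h : LogSobolev μ C) :
    TalagrandT2 μ C := by
  intro ν _
  rcases eq_or_ne (klDiv ν μ) ⊤ with htop | hfin
  · rw [htop, ENNReal.mul_top (by simpa using hC)]
    exact le_top
  have hμ := h.hasFiniteSecondMoment hC
  have hν := h.hasFiniteSecondMoment_of_klDiv_ne_top hC hfin
  set H := (klDiv ν μ).toReal with hH
  set w := (wasserstein ν μ).toReal with hw
  have hw0 : 0 ≤ w := ENNReal.toReal_nonneg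
  have hH0 : 0 ≤ H := ENNReal.toReal_nonneg
  have hwfin : wasserstein ν μ ≠ ⊤ := by
    obtain ⟨x₀⟩ : Nonempty X := nonempty_of_isProbabilityMeasure μ
    -- A Dirac mass, seen as an empirical measure of one point, is at finite distance from both
    -- measures.
    have := isProbabilityMeasure_empiricalMeasure one_pos (fun _ : Fin 1 => x₀)
    have h1 := wasserstein_triangle ν (empiricalMeasure (fun _ : Fin 1 => x₀)) μ
    rw [wasserstein_comm ν (empiricalMeasure _)] at h1
    exact ne_top_of_le_ne_top (ENNReal.add_ne_top.2
      ⟨wasserstein_empiricalMeasure_ne_top hν one_pos _,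
        wasserstein_empiricalMeasure_ne_top hμ one_pos _⟩) h1
  have key : ∀ l : ℝ, 0 < l → l * w ≤ H + C * l ^ 2 / 4 := by
    intro l hl
    have hn : ∀ n : ℕ, 0 < n →
        l * (w - ∫ x, min (empiricalDist ν n x) w ∂(Measure.pi fun _ : Fin n => ν)) ≤
        H + l * (∫ x, min (empiricalDist μ n x) w ∂(Measure.pi fun _ : Fin n => μ)) +
          C * l ^ 2 / 4 := by
      intro n hn
      exact mul_wasserstein_sub_le hgrad hC h hμ hν hfin hl hn
    have t1 : Tendsto (fun n : ℕ =>
        l * (w - ∫ x, min (empiricalDist ν n x) w ∂(Measure.pi fun _ : Fin n => ν)))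
        atTop (𝓝 (l * (w - 0))) :=
      (tendsto_const_nhds.sub (tendsto_integral_min_empiricalDist hν hw0)).const_mul l
    have t2 : Tendsto (fun n : ℕ => H + l * (∫ x, min (empiricalDist μ n x) w
        ∂(Measure.pi fun _ : Fin n => μ)) + C * l ^ 2 / 4) atTop (𝓝 (H + l * 0 + C * l ^ 2 / 4)) :=
      ((((tendsto_integral_min_empiricalDist hμ hw0).const_mul l).const_add H).add_const _)
    have := le_of_tendsto_of_tendsto t1 t2 ((eventually_gt_atTop 0).mono hn)
    simpa using this
  have hfinal : w ^ 2 ≤ C * H := by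
    rcases hw0.eq_or_lt with h0 | hwpos
    · rw [← h0]; simpa using mul_nonneg hC.le hH0
    -- The maximiser of `l w - C l² / 4`.
    have h1 := key (2 * w / C) (by positivity)
    have e1 : 2 * w / C * w = 2 * (w ^ 2 / C) := by ring
    have e2 : C * (2 * w / C) ^ 2 / 4 = w ^ 2 / C := by field_simp; ring
    rw [e1, e2] at h1
    have h2 : w ^ 2 / C ≤ H := by linarith
    rwa [div_le_iff₀ hC, mul_comm] at h2
  rw [← wasserstein_sq, ← ENNReal.ofReal_toReal hwfin, ← ENNReal.ofReal_toReal hfin,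
    ← ENNReal.ofReal_pow hw0, ← ENNReal.ofReal_mul hC.le]
  exact ENNReal.ofReal_le_ofReal hfinal

end Talagrand

/-! ### Riemannian distance and chart distance agree to first order. -/

section RiemannianCharts

variable {d : ℕ} {M : Type*} [MetricSpace M] [ChartedSpace (EuclideanSpace ℝ (Fin d)) M]
  [IsManifold (𝓡 d) 1 M]

/-- The linear isomorphism from the model space to the tangent space at `x` given by the preferred
chart at `x`. -/
noncomputable def frameAt (d : ℕ) {M : Type*} [MetricSpace M]
    [ChartedSpace (EuclideanSpace ℝ (Fin d)) M] [IsManifold (𝓡 d) 1 M] (x : M) :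
    TangentSpace (𝓡 d) x ≃L[ℝ] EuclideanSpace ℝ (Fin d) :=
  (trivializationAt (EuclideanSpace ℝ (Fin d)) (TangentSpace (𝓡 d)) x).continuousLinearEquivAt
    ℝ x (FiberBundle.mem_baseSet_trivializationAt' x)

theorem symmL_trivializationAt_self (x : M) (v : EuclideanSpace ℝ (Fin d)) :
    (trivializationAt (EuclideanSpace ℝ (Fin d)) (TangentSpace (𝓡 d)) x).symmL ℝ x v =
      (frameAt d x).symm v := by
  rw [frameAt, Bundle.Trivialization.symm_continuousLinearEquivAt_eq]

theorem continuousLinearMapAt_trivializationAt_self (x : M) (v : TangentSpace (𝓡 d) x) :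
    (trivializationAt (EuclideanSpace ℝ (Fin d)) (TangentSpace (𝓡 d)) x).continuousLinearMapAt ℝ x
      v = frameAt d x v := by
  rw [frameAt, Bundle.Trivialization.coe_continuousLinearEquivAt_eq]

variable [Bundle.RiemannianBundle (fun x : M => TangentSpace (𝓡 d) x)]
  [IsContinuousRiemannianBundle (EuclideanSpace ℝ (Fin d))
    (fun x : M => TangentSpace (𝓡 d) x)]

theorem eventually_enorm_symmL_le (x : M) {r : NNReal} (hr : 1 < r) :
    ∀ᶠ y in 𝓝 x, ∀ v : EuclideanSpace ℝ (Fin d),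
      ‖(trivializationAt (EuclideanSpace ℝ (Fin d)) (TangentSpace (𝓡 d)) x).symmL ℝ y v‖ₑ ≤
        r * ‖(frameAt d x).symm v‖ₑ := by
  filter_upwards [eventually_norm_symmL_trivializationAt_comp_self_lt (EuclideanSpace ℝ (Fin d))
    (fun x : M => TangentSpace (𝓡 d) x) x (NNReal.coe_lt_coe.2 hr)] with y hy v
  have h := ContinuousLinearMap.le_of_opNorm_le _ hy.le ((frameAt d x).symm v)
  rw [ContinuousLinearMap.comp_apply, continuousLinearMapAt_trivializationAt_self,
    ContinuousLinearEquiv.apply_symm_apply] at h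
  rw [← ofReal_norm, ← ofReal_norm, ← ENNReal.ofReal_coe_nnreal,
    ← ENNReal.ofReal_mul r.coe_nonneg]
  exact ENNReal.ofReal_le_ofReal h

theorem eventually_enorm_frameAt_symm_le (x : M) {r : NNReal} (hr : 1 < r) :
    ∀ᶠ y in 𝓝 x, ∀ v : TangentSpace (𝓡 d) y,
      ‖(frameAt d x).symm ((trivializationAt (EuclideanSpace ℝ (Fin d))
        (TangentSpace (𝓡 d)) x).continuousLinearMapAt ℝ y v)‖ₑ ≤ r * ‖v‖ₑ := by
  filter_upwards [eventually_norm_symmL_trivializationAt_self_comp_lt (EuclideanSpace ℝ (Fin d))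
    (fun x : M => TangentSpace (𝓡 d) x) x (NNReal.coe_lt_coe.2 hr)] with y hy v
  have h := ContinuousLinearMap.le_of_opNorm_le _ hy.le v
  rw [ContinuousLinearMap.comp_apply, symmL_trivializationAt_self] at h
  rw [← ofReal_norm, ← ofReal_norm, ← ENNReal.ofReal_coe_nnreal,
    ← ENNReal.ofReal_mul r.coe_nonneg]
  exact ENNReal.ofReal_le_ofReal h

open Manifold

/-- The image of a straight chart segment is a competing path, and by continuity the metric along it
is within a factor `r` of the metric at `x`. -/
theorem exists_ball_edist_extChartAt_symm_le [IsRiemannianManifold (𝓡 d) M] (x : M) {r : NNReal}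
    (hr : 1 < r) :
    ∃ ρ > 0, Metric.ball (extChartAt (𝓡 d) x x) ρ ⊆ (extChartAt (𝓡 d) x).target ∧
      ∀ u ∈ Metric.ball (extChartAt (𝓡 d) x x) ρ, ∀ v ∈ Metric.ball (extChartAt (𝓡 d) x x) ρ,
        edist ((extChartAt (𝓡 d) x).symm u) ((extChartAt (𝓡 d) x).symm v) ≤
          r * ‖(frameAt d x).symm (v - u)‖ₑ := by
  have h1 : ∀ᶠ u in 𝓝 (extChartAt (𝓡 d) x x), u ∈ (extChartAt (𝓡 d) x).target ∧
      ∀ v : EuclideanSpace ℝ (Fin d),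
      ‖(trivializationAt (EuclideanSpace ℝ (Fin d)) (TangentSpace (𝓡 d)) x).symmL ℝ
        ((extChartAt (𝓡 d) x).symm u) v‖ₑ ≤ r * ‖(frameAt d x).symm v‖ₑ := by
    have h3 : ∀ᶠ u in 𝓝 (extChartAt (𝓡 d) x x), u ∈ (extChartAt (𝓡 d) x).target :=
      extChartAt_target_mem_nhds x
    refine h3.and ?_
    have h2 : Tendsto (extChartAt (𝓡 d) x).symm (𝓝 (extChartAt (𝓡 d) x x)) (𝓝 x) := by
      have := continuousAt_extChartAt_symm (I := 𝓡 d) x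
      rwa [ContinuousAt, extChartAt_to_inv] at this
    exact h2.eventually (eventually_enorm_symmL_le x hr)
  obtain ⟨ρ, hρ, hb⟩ := Metric.eventually_nhds_iff_ball.1 h1
  refine ⟨ρ, hρ, fun u hu => (hb u hu).1, fun u hu v hv => ?_⟩
  set η : ℝ → EuclideanSpace ℝ (Fin d) := fun t => u + t • (v - u) with hη
  have hηd : ∀ t, HasDerivAt η (v - u) t := fun t => by
    simpa [hη] using ((hasDerivAt_id t).smul_const (v - u)).const_add u
  have hηc : ContDiff ℝ 1 η := by fun_prop
  have hηb : ∀ t ∈ Set.Icc (0 : ℝ) 1, η t ∈ Metric.ball (extChartAt (𝓡 d) x x) ρ := fun t ht =>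
    (convex_ball _ _).add_smul_sub_mem hu hv ht
  have hηs : ContMDiffOn 𝓘(ℝ, ℝ) (𝓡 d) 1 η (Set.Icc 0 1) :=
    hηc.contDiffOn.contMDiffOn
  have hγ : ContMDiffOn 𝓘(ℝ, ℝ) (𝓡 d) 1 ((extChartAt (𝓡 d) x).symm ∘ η) (Set.Icc 0 1) :=
    (contMDiffOn_extChartAt_symm x).comp hηs fun t ht => (hb _ (hηb t ht)).1
  rw [IsRiemannianManifold.out (I := 𝓡 d)]
  refine (riemannianEDist_le_pathELength hγ (by simp [hη]) (by simp [hη]) zero_le_one).trans ?_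
  rw [pathELength_eq_lintegral_mfderivWithin_Icc]
  calc _ ≤ ∫⁻ t in Set.Icc (0 : ℝ) 1, r * ‖(frameAt d x).symm (v - u)‖ₑ := by
        refine setLIntegral_mono' measurableSet_Icc fun t ht => ?_
        have hd : HasMFDerivWithinAt 𝓘(ℝ, ℝ) (𝓡 d) η (Set.Icc 0 1) t
            (ContinuousLinearMap.toSpanSingleton ℝ (v - u)) :=
          ((hηd t).hasFDerivAt.hasMFDerivAt).hasMFDerivWithinAt
        have hs : HasMFDerivWithinAt (𝓡 d) (𝓡 d) (extChartAt (𝓡 d) x).symm (Set.range (𝓡 d)) (η t)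
            (mfderivWithin (𝓡 d) (𝓡 d) (extChartAt (𝓡 d) x).symm (Set.range (𝓡 d)) (η t)) :=
          (mdifferentiableWithinAt_extChartAt_symm (hb _ (hηb t ht)).1).hasMFDerivWithinAt
        have hc := (hs.comp t hd (fun t ht => by simp)).mfderivWithin
          (uniqueMDiffWithinAt_iff_uniqueDiffWithinAt.2 (uniqueDiffOn_Icc zero_lt_one t ht))
        have hsrc : (extChartAt (𝓡 d) x).symm (η t) ∈
            (chartAt (EuclideanSpace ℝ (Fin d)) x).source := by
          have := (extChartAt (𝓡 d) x).map_target (hb _ (hηb t ht)).1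
          rwa [extChartAt_source] at this
        have hT := TangentBundle.symmL_trivializationAt (I := 𝓡 d) hsrc
        rw [(extChartAt (𝓡 d) x).right_inv (hb _ (hηb t ht)).1] at hT
        have h3 := (hb _ (hηb t ht)).2 (v - u)
        rw [hT] at h3
        refine le_trans (le_of_eq ?_) h3
        rw [hc]
        congr 1
        have : (ContinuousLinearMap.toSpanSingleton ℝ (v - u)) (1 : ℝ) = v - u := by simp
        conv_rhs => rw [← this]
        rfl
    _ = _ := by simp

/-- Conversely, read an almost minimising path in the chart: measured in the norm at `x`, its
displacement is at most `r` times its length. -/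
theorem eventually_enorm_extChartAt_sub_le [IsRiemannianManifold (𝓡 d) M] (x : M) {r : NNReal}
    (hr : 1 < r) :
    ∀ᶠ y in 𝓝 x, ‖(frameAt d x).symm (extChartAt (𝓡 d) x y - extChartAt (𝓡 d) x x)‖ₑ ≤
      r * edist x y := by
  have h1 : ∀ᶠ y in 𝓝 x, y ∈ (chartAt (EuclideanSpace ℝ (Fin d)) x).source :=
    chart_source_mem_nhds (EuclideanSpace ℝ (Fin d)) x
  obtain ⟨ρ, hρ, hb⟩ := Metric.nhds_basis_eball.eventually_iff.1
    ((eventually_enorm_frameAt_symm_le (d := d) x hr).and h1)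
  have hr0 : (r : ℝ≥0∞) ≠ 0 := by simpa using (zero_lt_one.trans hr).ne'
  filter_upwards [Metric.eball_mem_nhds x hρ] with y hy
  rw [← ENNReal.div_le_iff' hr0 ENNReal.coe_ne_top]
  refine le_of_forall_gt fun c hc => ?_
  rw [ENNReal.div_lt_iff (Or.inl hr0) (Or.inl ENNReal.coe_ne_top), mul_comm]
  rw [Metric.mem_eball'] at hy
  -- Keeping the length below `ρ` as well confines the whole path to the ball where the metrics are
  -- comparable.
  obtain ⟨c', hxc', hcc'⟩ := exists_between (lt_min hc hy)
  rw [IsRiemannianManifold.out (I := 𝓡 d)] at hxc'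
  obtain ⟨γ, hγ0, hγ1, hγs, hγl⟩ := exists_lt_of_riemannianEDist_lt hxc'
  have hmem : ∀ t ∈ Set.Icc (0 : ℝ) 1, γ t ∈ Metric.eball x ρ := fun t ht => by
    rw [Metric.mem_eball', IsRiemannianManifold.out (I := 𝓡 d)]
    calc _ ≤ pathELength (𝓡 d) γ 0 t :=
          riemannianEDist_le_pathELength (hγs.mono (Set.Icc_subset_Icc_right ht.2)) hγ0 rfl ht.1
      _ ≤ pathELength (𝓡 d) γ 0 1 := pathELength_mono le_rfl ht.2
      _ < ρ := hγl.trans (hcc'.trans_le (min_le_right _ _))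
  have hsm : ContMDiffOn 𝓘(ℝ, ℝ) (𝓡 d) 1 (extChartAt (𝓡 d) x ∘ γ) (Set.Icc 0 1) :=
    contMDiffOn_extChartAt.comp hγs fun t ht => (hb (hmem t ht)).2
  have hlen : ∀ t ∈ Set.Icc (0 : ℝ) 1,
      ‖(frameAt d x).symm (derivWithin (extChartAt (𝓡 d) x ∘ γ) (Set.Icc 0 1) t)‖ₑ ≤
        r * ‖mfderivWithin 𝓘(ℝ, ℝ) (𝓡 d) γ (Set.Icc 0 1) t 1‖ₑ := fun t ht => by
    refine le_trans (le_of_eq ?_) ((hb (hmem t ht)).1 _)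
    rw [TangentBundle.continuousLinearMapAt_trivializationAt (hb (hmem t ht)).2]
    have hcomp := mfderiv_comp_mfderivWithin (I := 𝓘(ℝ, ℝ)) (I' := 𝓡 d) (I'' := 𝓡 d)
      (g := extChartAt (𝓡 d) x) (f := γ) (s := Set.Icc 0 1) t
      (mdifferentiableAt_extChartAt (hb (hmem t ht)).2)
      (hγs.mdifferentiableOn one_ne_zero t ht)
      (uniqueMDiffWithinAt_iff_uniqueDiffWithinAt.2 (uniqueDiffOn_Icc zero_lt_one t ht))
    have hval := congrArg (fun L => L 1) hcomp
    rw [← fderivWithin_derivWithin]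
    rw [mfderivWithin_eq_fderivWithin] at hval
    congr 2
  have hcd : ContDiffOn ℝ 1 (fun t => (frameAt d x).symm ((extChartAt (𝓡 d) x ∘ γ) t))
      (Set.Icc 0 1) :=
    (frameAt d x).symm.contDiff.comp_contDiffOn (contMDiffOn_iff_contDiffOn.1 hsm)
  calc ‖(frameAt d x).symm (extChartAt (𝓡 d) x y - extChartAt (𝓡 d) x x)‖ₑ
      = ‖(frameAt d x).symm ((extChartAt (𝓡 d) x ∘ γ) 1) -
          (frameAt d x).symm ((extChartAt (𝓡 d) x ∘ γ) 0)‖ₑ := by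
        rw [← map_sub, Function.comp_apply, Function.comp_apply, hγ0, hγ1]
    _ ≤ ∫⁻ t in Set.Icc (0 : ℝ) 1, ‖derivWithin
          (fun t => (frameAt d x).symm ((extChartAt (𝓡 d) x ∘ γ) t)) (Set.Icc 0 1) t‖ₑ :=
        enorm_sub_le_lintegral_derivWithin_Icc_of_contDiffOn_Icc hcd zero_le_one
    _ ≤ ∫⁻ t in Set.Icc (0 : ℝ) 1,
          r * ‖mfderivWithin 𝓘(ℝ, ℝ) (𝓡 d) γ (Set.Icc 0 1) t 1‖ₑ := by
        refine setLIntegral_mono' measurableSet_Icc fun t ht => ?_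
        refine le_trans (le_of_eq ?_) (hlen t ht)
        congr 1
        have hdiff := ((contMDiffOn_iff_contDiffOn.1 hsm).differentiableOn one_ne_zero) t ht
        exact ((frameAt d x).symm.hasFDerivAt.comp_hasDerivWithinAt t
          hdiff.hasDerivWithinAt).derivWithin (uniqueDiffOn_Icc zero_lt_one t ht)
    _ = r * pathELength (𝓡 d) γ 0 1 := by
        rw [lintegral_const_mul' _ _ ENNReal.coe_ne_top,
          pathELength_eq_lintegral_mfderivWithin_Icc]
    _ < r * c := by
        gcongr
        · exact ENNReal.coe_ne_top
        · exact hγl.trans (hcc'.trans_le (min_le_left _ _))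

end RiemannianCharts

/-! ### The gradient bound at a point of differentiability. -/

section PointwiseGradientBound

variable {X : Type*} [MetricSpace X]

theorem partialGradLength_le_of_eventually {n : ℕ} {F : (Fin n → X) → ℝ} {i : Fin n}
    {x : Fin n → X} {a : ℝ} (ha : 0 ≤ a)
    (h : ∀ c > a, ∀ᶠ y in 𝓝 (x i), |F (Function.update x i y) - F x| ≤ c * dist y (x i)) :
    partialGradLength F i x ≤ ENNReal.ofReal a := by
  refine ENNReal.le_of_forall_pos_le_add fun ε hε _ => ?_
  have hc := h (a + ε) (by simpa using hε)
  refine limsup_le_of_le (by isBoundedDefault) ?_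
  filter_upwards [nhdsWithin_le_nhds hc, self_mem_nhdsWithin] with y hy hne
  have hpos : 0 < dist y (x i) := dist_pos.2 hne
  rw [Function.update_eq_self, edist_comm, edist_comm (x i), edist_dist, edist_dist,
    ← ENNReal.ofReal_div_of_pos hpos, ← ENNReal.ofReal_coe_nnreal,
    ← ENNReal.ofReal_add ha ε.coe_nonneg, Real.dist_eq]
  exact ENNReal.ofReal_le_ofReal ((div_le_iff₀ hpos).2 hy)

theorem eventually_abs_sub_le_of_hasFDerivAt {V : Type*} [NormedAddCommGroup V] [NormedSpace ℝ V]
    {g : V → ℝ} {L : V →L[ℝ] ℝ} (hg : HasFDerivAt g L 0) {c : ℝ} (hc : ‖L‖ < c) :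
    ∀ᶠ v in 𝓝 (0 : V), |g v - g 0| ≤ c * ‖v‖ := by
  filter_upwards [hg.isLittleO.def (sub_pos.2 hc)] with v hv
  rw [sub_zero, Real.norm_eq_abs] at hv
  have h1 : |L v| ≤ ‖L‖ * ‖v‖ := L.le_opNorm v
  have h2 := abs_add_le (g v - g 0 - L v) (L v)
  rw [sub_add_cancel] at h2
  linarith

/-- The bound on the squared partial gradient lengths at a point where the function is
differentiable in charts which are isometric to first order at that point. -/
theorem sum_partialGradLength_sq_le {E : Type*} [NormedAddCommGroup E] [InnerProductSpace ℝ E]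
    [CompleteSpace E] {n : ℕ} (hn : 0 < n) {F : (Fin n → X) → ℝ} {x : Fin n → X}
    (hF : ∀ y, |F y - F x| ≤ √((n : ℝ)⁻¹ * ∑ i, dist (y i) (x i) ^ 2))
    {θ : Fin n → E → X} {ψ : Fin n → X → E} (hθ0 : ∀ i, θ i 0 = x i)
    (hθψ : ∀ i, ∀ᶠ y in 𝓝 (x i), θ i (ψ i y) = y)
    (hθ : ∀ i, ∀ r : ℝ, 1 < r → ∀ᶠ v in 𝓝 0, dist (θ i v) (x i) ≤ r * ‖v‖)
    (hψ : ∀ i, ∀ r : ℝ, 1 < r → ∀ᶠ y in 𝓝 (x i), ‖ψ i y‖ ≤ r * dist y (x i))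
    (hd : DifferentiableAt ℝ (fun v : Fin n → E => F fun i => θ i (v i)) 0) :
    ∑ i, partialGradLength F i x ^ 2 ≤ (n : ℝ≥0∞)⁻¹ := by
  set G : (Fin n → E) → ℝ := fun v => F fun i => θ i (v i) with hG
  set L := fderiv ℝ G 0
  have hL : HasFDerivAt G L 0 := hd.hasFDerivAt
  have hG0 : G 0 = F x := by simp [hG, hθ0]
  set Li : Fin n → E →L[ℝ] ℝ := fun i => L ∘L ContinuousLinearMap.single ℝ (fun _ => E) i
  have hLi : ∀ i, HasFDerivAt (fun v => G (Pi.single i v)) (Li i) 0 := fun i => by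
    have h1 : HasFDerivAt (fun v : E => (Pi.single i v : Fin n → E))
        (ContinuousLinearMap.single ℝ (fun _ => E) i) 0 :=
      (ContinuousLinearMap.single ℝ (fun _ => E) i).hasFDerivAt
    have h2 : HasFDerivAt G L (Pi.single i (0 : E)) := by simpa using hL
    exact h2.comp 0 h1
  have hpart : ∀ i, partialGradLength F i x ≤ ENNReal.ofReal ‖Li i‖ := fun i => by
    refine partialGradLength_le_of_eventually (norm_nonneg _) fun c hc => ?_
    -- The gap between `b` and `c` pays for the distortion factor `c / b` of the chart.
    obtain ⟨b, hb1, hb2⟩ := exists_between hc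
    have hb0 : 0 < b := (norm_nonneg _).trans_lt hb1
    have hψt : Tendsto (ψ i) (𝓝 (x i)) (𝓝 0) := by
      refine squeeze_zero_norm' (hψ i 2 one_lt_two) ?_
      have : Tendsto (fun y => 2 * dist y (x i)) (𝓝 (x i)) (𝓝 (2 * dist (x i) (x i))) :=
        ((continuous_id.dist continuous_const).const_mul 2).tendsto _
      simpa using this
    filter_upwards [hψt.eventually (eventually_abs_sub_le_of_hasFDerivAt (hLi i) hb1), hθψ i,
      hψ i (c / b) ((one_lt_div hb0).2 hb2)] with y h1 h2 h3
    have h4 : G (Pi.single i (ψ i y)) = F (Function.update x i y) := by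
      simp only [hG]
      congr 1
      ext j
      obtain rfl | hj := eq_or_ne j i
      · simp [h2]
      · simp [hj, hθ0]
    rw [h4, Pi.single_zero, hG0] at h1
    refine h1.trans ((mul_le_mul_of_nonneg_left h3 hb0.le).trans_eq ?_)
    field_simp
  set S := ∑ i, ‖Li i‖ ^ 2 with hS
  have hS0 : 0 ≤ S := by positivity
  -- The gradient direction: along `t • v` the derivative is `S`, while the `ℓ²` Lipschitz bound
  -- with chart distortion `r → 1` allows at most `√(S / n)`.
  set v : Fin n → E := fun i => (InnerProductSpace.toDual ℝ E).symm (Li i) with hv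
  have hvn : ∀ i, ‖v i‖ = ‖Li i‖ := fun i => by simp [hv]
  have hLv : L v = S := by
    have h1 : L v = ∑ i, Li i (v i) := by
      conv_lhs => rw [← Finset.univ_sum_single v, map_sum]
      rfl
    rw [h1, hS]
    refine Finset.sum_congr rfl fun i _ => ?_
    rw [← hvn i, ← real_inner_self_eq_norm_sq]
    nth_rw 2 [hv]
    rw [InnerProductSpace.toDual_symm_apply]
  have hn' : (0 : ℝ) < n := by exact_mod_cast hn
  have hSle : S ≤ √((n : ℝ)⁻¹ * S) := by
    refine (le_iff_forall_one_lt_le_mul₀ (Real.sqrt_nonneg _)).2 fun r hr => ?_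
    have h1 : HasDerivAt (fun t : ℝ => G (t • v)) S 0 := by
      have h2 : HasDerivAt (fun t : ℝ => t • v) v 0 := by
        simpa using (hasDerivAt_id (0 : ℝ)).smul_const v
      rw [← hLv]
      have h3 : HasFDerivAt G L ((0 : ℝ) • v) := by rwa [zero_smul]
      exact h3.comp_hasDerivAt (0 : ℝ) h2
    have hr0 : 0 < r := zero_lt_one.trans hr
    have h2 : ∀ᶠ t : ℝ in 𝓝 0, ∀ i, dist (θ i (t • v i)) (x i) ≤ r * ‖t • v i‖ := by
      refine eventually_all.2 fun i => ?_
      have h3 : Tendsto (fun t : ℝ => t • v i) (𝓝 0) (𝓝 0) := by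
        have : Continuous fun t : ℝ => t • v i := by fun_prop
        simpa using this.tendsto 0
      exact h3.eventually (hθ i r hr)
    have h3 := h1.le_of_lip' (C := √((n : ℝ)⁻¹ * S) * r) (by positivity) (by
      filter_upwards [h2] with t ht
      rw [zero_smul, hG0, sub_zero]
      refine (hF _).trans ?_
      have h4 : ∑ i, dist (θ i (t • v i)) (x i) ^ 2 ≤ (r * |t|) ^ 2 * S := by
        rw [hS, Finset.mul_sum]
        gcongr with i
        calc _ ≤ (r * ‖t • v i‖) ^ 2 := by
              gcongr
              exact ht i
          _ = _ := by rw [norm_smul, hvn, Real.norm_eq_abs]; ring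
      calc _ ≤ √((n : ℝ)⁻¹ * ((r * |t|) ^ 2 * S)) := by
            gcongr
            exact h4
        _ = √((r * |t|) ^ 2 * ((n : ℝ)⁻¹ * S)) := by congr 1; ring
        _ = _ := by
            rw [Real.sqrt_mul (by positivity), Real.sqrt_sq (by positivity), Real.norm_eq_abs]
            ring)
    rwa [Real.norm_of_nonneg hS0] at h3
  have hSn : S ≤ (n : ℝ)⁻¹ := by
    have h1 : S ^ 2 ≤ (n : ℝ)⁻¹ * S := by
      have := pow_le_pow_left₀ hS0 hSle 2
      rwa [Real.sq_sqrt (by positivity)] at this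
    rcases hS0.eq_or_lt with h | h
    · rw [← h]; positivity
    · nlinarith
  calc ∑ i, partialGradLength F i x ^ 2 ≤ ∑ i, ENNReal.ofReal ‖Li i‖ ^ 2 := by
        gcongr with i
        exact hpart i
    _ = ENNReal.ofReal S := by
        rw [hS, ENNReal.ofReal_sum_of_nonneg fun i _ => by positivity]
        exact Finset.sum_congr rfl fun i _ => (ENNReal.ofReal_pow (norm_nonneg _) 2).symm
    _ ≤ ENNReal.ofReal (n : ℝ)⁻¹ := ENNReal.ofReal_le_ofReal hSn
    _ = (n : ℝ≥0∞)⁻¹ := by rw [ENNReal.ofReal_inv_of_pos hn', ENNReal.ofReal_natCast]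

end PointwiseGradientBound

/-! ### Charts isometric to first order; topology of the manifold. -/

section MetricChart

variable {d : ℕ} {M : Type*} [MetricSpace M] [ChartedSpace (EuclideanSpace ℝ (Fin d)) M]
  [Bundle.RiemannianBundle (fun x : M => TangentSpace (𝓡 d) x)]

variable (d) in
theorem exists_linearIsometryEquiv_tangentSpace (x : M) :
    Nonempty (TangentSpace (𝓡 d) x ≃ₗᵢ[ℝ] EuclideanSpace ℝ (Fin d)) := by
  have : FiniteDimensional ℝ (TangentSpace (𝓡 d) x) :=
    inferInstanceAs (FiniteDimensional ℝ (EuclideanSpace ℝ (Fin d)))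
  have h : Module.finrank ℝ (TangentSpace (𝓡 d) x) = d :=
    finrank_euclideanSpace_fin (𝕜 := ℝ)
  exact ⟨((stdOrthonormalBasis ℝ (TangentSpace (𝓡 d) x)).reindex (finCongr h)).repr⟩

/-- Precompose the inverse chart with a linear map carrying the Euclidean norm to the tangent norm
at `x`. The last clause is needed because Rademacher is applied in fixed charts around other centres
`c`. -/
theorem exists_metric_chart [IsManifold (𝓡 d) 1 M]
    [IsContinuousRiemannianBundle (EuclideanSpace ℝ (Fin d))
      (fun x : M => TangentSpace (𝓡 d) x)] [IsRiemannianManifold (𝓡 d) M] (x : M) :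
    ∃ (θ : EuclideanSpace ℝ (Fin d) → M) (ψ : M → EuclideanSpace ℝ (Fin d)),
      θ 0 = x ∧ (∀ᶠ y in 𝓝 x, θ (ψ y) = y) ∧
      (∀ r : ℝ, 1 < r → ∀ᶠ v in 𝓝 0, dist (θ v) x ≤ r * ‖v‖) ∧
      (∀ r : ℝ, 1 < r → ∀ᶠ y in 𝓝 x, ‖ψ y‖ ≤ r * dist y x) ∧ ContinuousAt θ 0 ∧
      ∀ c : M, x ∈ (extChartAt (𝓡 d) c).source →
        DifferentiableAt ℝ (fun v => extChartAt (𝓡 d) c (θ v)) 0 := by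
  obtain ⟨J⟩ := exists_linearIsometryEquiv_tangentSpace d x
  set A : EuclideanSpace ℝ (Fin d) ≃L[ℝ] EuclideanSpace ℝ (Fin d) :=
    J.symm.toContinuousLinearEquiv.trans (frameAt d x) with hA
  have hAn : ∀ w, ‖(frameAt d x).symm w‖ = ‖A.symm w‖ := fun w => (J.norm_map _).symm
  have ht : Tendsto (fun v => extChartAt (𝓡 d) x x + A v) (𝓝 0) (𝓝 (extChartAt (𝓡 d) x x)) := by
    have : Continuous fun v => extChartAt (𝓡 d) x x + A v := by fun_prop
    simpa using this.tendsto 0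
  refine ⟨fun v => (extChartAt (𝓡 d) x).symm (extChartAt (𝓡 d) x x + A v),
    fun y => A.symm (extChartAt (𝓡 d) x y - extChartAt (𝓡 d) x x), by simp, ?_,
    fun r hr => ?_, fun r hr => ?_, ?_, fun c hc => ?_⟩
  · filter_upwards [extChartAt_source_mem_nhds (I := 𝓡 d) x] with y hy
    simp [-extChartAt, (extChartAt (𝓡 d) x).left_inv hy]
  · lift r to NNReal using by linarith
    obtain ⟨ρ, hρ, -, hb⟩ := exists_ball_edist_extChartAt_symm_le (d := d) x
      (NNReal.coe_lt_coe.1 hr)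
    filter_upwards [ht.eventually (Metric.ball_mem_nhds _ hρ)] with v hv
    have h1 := hb _ (Metric.mem_ball_self hρ) _ hv
    rw [extChartAt_to_inv, add_sub_cancel_left, edist_comm, edist_dist, ← ofReal_norm, hAn,
      ContinuousLinearEquiv.symm_apply_apply, ← ENNReal.ofReal_coe_nnreal,
      ← ENNReal.ofReal_mul r.coe_nonneg] at h1
    exact (ENNReal.ofReal_le_ofReal_iff (by positivity)).1 h1
  · lift r to NNReal using by linarith
    filter_upwards [eventually_enorm_extChartAt_sub_le (d := d) x (NNReal.coe_lt_coe.1 hr)]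
      with y h1
    rw [edist_comm, edist_dist, ← ofReal_norm, hAn, ← ENNReal.ofReal_coe_nnreal,
      ← ENNReal.ofReal_mul r.coe_nonneg] at h1
    exact (ENNReal.ofReal_le_ofReal_iff (by positivity)).1 h1
  · have h1 : ContinuousAt (extChartAt (𝓡 d) x).symm (extChartAt (𝓡 d) x x + A 0) := by
      simpa [-extChartAt] using continuousAt_extChartAt_symm (I := 𝓡 d) x
    exact h1.comp (f := fun v => extChartAt (𝓡 d) x x + A v) (by fun_prop)
  · have h1 : MDifferentiableAt (𝓡 d) (𝓡 d) (extChartAt (𝓡 d) x).symm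
        (extChartAt (𝓡 d) x x + A 0) := by
      have := mdifferentiableWithinAt_extChartAt_symm (I := 𝓡 d)
        (mem_extChartAt_target (I := 𝓡 d) x)
      simpa [-extChartAt, mdifferentiableWithinAt_univ] using this
    have h2 : MDifferentiableAt (𝓡 d) (𝓡 d) (extChartAt (𝓡 d) c)
        ((extChartAt (𝓡 d) x).symm (extChartAt (𝓡 d) x x + A 0)) := by
      have := mdifferentiableAt_extChartAt (I := 𝓡 d) (x := c) (y := x)
        (by rwa [extChartAt_source] at hc)
      rwa [map_zero, add_zero, extChartAt_to_inv]
    have h3 := (mdifferentiableAt_iff_differentiableAt.1 (h2.comp _ h1))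
    exact h3.comp (0 : EuclideanSpace ℝ (Fin d)) (f := fun v => extChartAt (𝓡 d) x x + A v)
      (by fun_prop)

end MetricChart

/-- Completeness is not assumed: a locally compact space is open in its completion, since a small
ball of the completion lies in the closure of its trace, hence in a compact subset of `X`. Open
subsets of Polish spaces are Polish. -/
theorem polishSpace_of_locallyCompactSpace (X : Type*) [MetricSpace X] [LocallyCompactSpace X]
    [SecondCountableTopology X] : PolishSpace X := by
  have hemb : IsEmbedding ((↑) : X → UniformSpace.Completion X) :=
    UniformSpace.Completion.isUniformEmbedding_coe X |>.isEmbedding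
  have hopen : IsOpen (Set.range ((↑) : X → UniformSpace.Completion X)) := by
    refine Metric.isOpen_iff.2 ?_
    rintro _ ⟨x, rfl⟩
    obtain ⟨K, hK, hKx⟩ := exists_compact_mem_nhds x
    obtain ⟨ε, hε, hb⟩ := Metric.mem_nhds_iff.1 hKx
    refine ⟨ε, hε, ?_⟩
    calc Metric.ball (x : UniformSpace.Completion X) ε
        ⊆ closure (Metric.ball (x : UniformSpace.Completion X) ε ∩
            Set.range ((↑) : X → UniformSpace.Completion X)) :=
          UniformSpace.Completion.denseRange_coe.open_subset_closure_inter Metric.isOpen_ball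
      _ ⊆ (↑) '' K := by
          refine closure_minimal ?_ (hK.image hemb.continuous).isClosed
          rintro _ ⟨hy, y, rfl⟩
          refine ⟨y, hb ?_, rfl⟩
          rwa [Metric.mem_ball, UniformSpace.Completion.dist_eq] at hy
      _ ⊆ _ := Set.image_subset_range _ _
  have := hopen.polishSpace
  exact hemb.toHomeomorph.isClosedEmbedding.polishSpace

theorem pi_absolutelyContinuous {α : Type*} [MeasurableSpace α] :
    ∀ {n : ℕ} {μ ν : Fin n → Measure α} [∀ i, SigmaFinite (μ i)] [∀ i, SigmaFinite (ν i)],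
      (∀ i, μ i ≪ ν i) → Measure.pi μ ≪ Measure.pi ν
  | 0, μ, ν, _, _, _ => by
    rw [Measure.pi_of_empty, Measure.pi_of_empty]
  | n + 1, μ, ν, _, _, h => by
    have h1 := (measurePreserving_piFinSuccAbove μ 0).symm.map_eq
    have h2 := (measurePreserving_piFinSuccAbove ν 0).symm.map_eq
    rw [← h1, ← h2]
    exact ((h 0).prod (pi_absolutelyContinuous fun i => h (Fin.succAbove 0 i))).map
      (MeasurableEquiv.measurable _)

/-! ### Rademacher's theorem on products of manifolds. -/

section Charts

variable {d : ℕ} {M : Type*} [MetricSpace M] [ChartedSpace (EuclideanSpace ℝ (Fin d)) M]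
  [IsManifold (𝓡 d) 1 M]

/-- The hypothesis on `μ` asks for null images in every chart. Nullity in the chart at `c` suffices,
since transition maps are differentiable and so preserve Lebesgue-null sets. -/
theorem ManifoldAbsolutelyContinuous.map_extChartAt [MeasurableSpace M] [BorelSpace M]
    {μ : Measure M}
    (hμ : ManifoldAbsolutelyContinuous d μ) (c : M) {N : Set M} (hN : MeasurableSet N)
    (hNs : N ⊆ (extChartAt (𝓡 d) c).source) :
    (μ.restrict N).map (extChartAt (𝓡 d) c) ≪ volume := by
  have hcont : ContinuousOn (extChartAt (𝓡 d) c) N := (continuousOn_extChartAt c).mono hNs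
  have hmeas : AEMeasurable (extChartAt (𝓡 d) c) (μ.restrict N) := hcont.aemeasurable hN
  refine Measure.AbsolutelyContinuous.mk fun t ht h0 => ?_
  rw [Measure.map_apply_of_aemeasurable hmeas ht]
  have hs : MeasurableSet (N ∩ extChartAt (𝓡 d) c ⁻¹' t) := by
    have h1 : Measurable (N.domRestrict (extChartAt (𝓡 d) c)) :=
      (continuousOn_iff_continuous_domRestrict.1 hcont).measurable
    have h2 := hN.subtype_image (h1 ht)
    convert h2 using 1
    ext y
    constructor
    · rintro ⟨h, h'⟩
      exact ⟨⟨y, h⟩, h', rfl⟩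
    · rintro ⟨z, hz, rfl⟩
      exact ⟨z.2, hz⟩
  have h2 : μ (N ∩ extChartAt (𝓡 d) c ⁻¹' t) = 0 := by
    refine hμ _ hs fun e he => ?_
    set s := N ∩ extChartAt (𝓡 d) c ⁻¹' t ∩ e.source
    have himg : e '' s = (e ∘ (extChartAt (𝓡 d) c).symm) '' (extChartAt (𝓡 d) c '' s) := by
      rw [Set.image_image]
      refine Set.image_congr fun y hy => ?_
      rw [Function.comp_apply, (extChartAt (𝓡 d) c).left_inv (hNs hy.1.1)]
    rw [himg]
    refine addHaar_image_eq_zero_of_differentiableOn_of_addHaar_eq_zero volume ?_ ?_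
    · rintro _ ⟨y, hy, rfl⟩
      have hy' := (extChartAt (𝓡 d) c).left_inv (hNs hy.1.1)
      have h3 : MDifferentiableAt (𝓡 d) (𝓡 d) (extChartAt (𝓡 d) c).symm
          (extChartAt (𝓡 d) c y) := by
        have := mdifferentiableWithinAt_extChartAt_symm (I := 𝓡 d)
          ((extChartAt (𝓡 d) c).map_source (hNs hy.1.1))
        simpa [-extChartAt, mdifferentiableWithinAt_univ] using this
      have h4 : MDifferentiableAt (𝓡 d) (𝓡 d) e
          ((extChartAt (𝓡 d) c).symm (extChartAt (𝓡 d) c y)) := by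
        rw [hy']
        exact mdifferentiableAt_atlas he hy.2
      exact (mdifferentiableAt_iff_differentiableAt.1 (h4.comp _ h3)).differentiableWithinAt
    · refine measure_mono_null ?_ h0
      rintro _ ⟨y, hy, rfl⟩
      exact hy.1.2
  rw [Measure.restrict_apply₀' hN.nullMeasurableSet, Set.inter_comm]
  exact h2

variable [Bundle.RiemannianBundle (fun x : M => TangentSpace (𝓡 d) x)]
  [IsContinuousRiemannianBundle (EuclideanSpace ℝ (Fin d))
    (fun x : M => TangentSpace (𝓡 d) x)] [IsRiemannianManifold (𝓡 d) M]

variable (d) in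
theorem exists_lipschitzOnWith_extChartAt_symm (x : M) :
    ∃ ρ > 0, Metric.ball (extChartAt (𝓡 d) x x) ρ ⊆ (extChartAt (𝓡 d) x).target ∧
      ∃ K, LipschitzOnWith K (extChartAt (𝓡 d) x).symm (Metric.ball (extChartAt (𝓡 d) x x) ρ) := by
  obtain ⟨ρ, hρ, ht, hb⟩ := exists_ball_edist_extChartAt_symm_le (d := d) x one_lt_two
  refine ⟨ρ, hρ, ht,
    2 * ‖((frameAt d x).symm : EuclideanSpace ℝ (Fin d) →L[ℝ] TangentSpace (𝓡 d) x)‖₊,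
    fun u hu v hv => (hb u hu v hv).trans ?_⟩
  rw [edist_comm, edist_eq_enorm_sub, ENNReal.coe_mul, mul_assoc]
  gcongr
  exact ((frameAt d x).symm : EuclideanSpace ℝ (Fin d) →L[ℝ] TangentSpace (𝓡 d) x).le_opENorm _

variable [MeasurableSpace M] [BorelSpace M] [SecondCountableTopology M]

/-- Almost every point is a point where the gradient bound holds, for a function which is Lipschitz
for the `ℓ²` product distance. -/
theorem ae_sum_partialGradLength_sq_le {μ : Measure M} [IsFiniteMeasure μ]
    (hμ : ManifoldAbsolutelyContinuous d μ) {n : ℕ} (hn : 0 < n) {F : (Fin n → M) → ℝ}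
    (hF : ∀ x y, |F x - F y| ≤ √((n : ℝ)⁻¹ * ∑ i, dist (x i) (y i) ^ 2))
    (hLip : LipschitzWith 1 F) :
    ∀ᵐ x ∂(Measure.pi fun _ : Fin n => μ),
      ∑ i, partialGradLength F i x ^ 2 ≤ (n : ℝ≥0∞)⁻¹ := by
  choose ρ hρ hρt K hK using exists_lipschitzOnWith_extChartAt_symm d (M := M)
  set N : M → Set M := fun c => (extChartAt (𝓡 d) c).source ∩
    extChartAt (𝓡 d) c ⁻¹' Metric.ball (extChartAt (𝓡 d) c c) (ρ c) with hN
  have hNo : ∀ c, IsOpen (N c) := fun c =>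
    (continuousOn_extChartAt c).isOpen_inter_preimage (isOpen_extChartAt_source c)
      Metric.isOpen_ball
  -- By Lindelöf, countably many chart balls cover `M`, hence countably many products of them cover
  -- `Mⁿ`, and null sets may be treated one product at a time.
  obtain ⟨s, hsc, hs⟩ := TopologicalSpace.countable_cover_nhds fun c : M =>
    (hNo c).mem_nhds ⟨mem_extChartAt_source c, Metric.mem_ball_self (hρ c)⟩
  have := hsc.to_subtype
  have key : ∀ c : Fin n → s, ∀ᵐ x ∂(Measure.pi fun _ : Fin n => μ), (∀ i, x i ∈ N (c i)) →
      ∑ i, partialGradLength F i x ^ 2 ≤ (n : ℝ≥0∞)⁻¹ := fun c => by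
    set U : Set (Fin n → EuclideanSpace ℝ (Fin d)) :=
      Set.univ.pi fun i => Metric.ball (extChartAt (𝓡 d) (c i : M) (c i)) (ρ (c i)) with hU
    have hUo : IsOpen U := isOpen_set_pi Set.finite_univ fun i _ => Metric.isOpen_ball
    set Fc : (Fin n → EuclideanSpace ℝ (Fin d)) → ℝ :=
      fun u => F fun i => (extChartAt (𝓡 d) (c i : M)).symm (u i) with hFc
    have hFcL : LipschitzOnWith (∑ i, K (c i)) Fc U := by
      have h1 : LipschitzOnWith (∑ i, K (c i)) (fun (u : Fin n → EuclideanSpace ℝ (Fin d)) i =>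
          (extChartAt (𝓡 d) (c i : M)).symm (u i)) U := by
        intro u hu v hv
        refine edist_pi_le_iff.2 fun i => ?_
        refine (hK (c i) (hu i trivial) (hv i trivial)).trans ?_
        gcongr
        · exact Finset.single_le_sum (f := fun i => K (c i)) (fun _ _ => zero_le)
            (Finset.mem_univ i)
        · exact edist_le_pi_edist u v i
      have h2 := hLip.comp_lipschitzOnWith h1
      rwa [one_mul] at h2
    have hrad : ∀ᵐ u ∂(Measure.pi fun _ : Fin n => (volume : Measure (EuclideanSpace ℝ (Fin d)))),
        u ∈ U → DifferentiableAt ℝ Fc u := by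
      filter_upwards [hFcL.ae_differentiableWithinAt_of_mem (μ := Measure.pi fun _ : Fin n =>
        (volume : Measure (EuclideanSpace ℝ (Fin d))))] with u hu huU
      exact (hu huU).differentiableAt (hUo.mem_nhds huU)
    have hae : ∀ i, AEMeasurable (extChartAt (𝓡 d) (c i : M)) (μ.restrict (N (c i))) := fun i =>
      ((continuousOn_extChartAt _).mono Set.inter_subset_left).aemeasurable (hNo _).measurableSet
    have hac : Measure.pi (fun i => (μ.restrict (N (c i))).map (extChartAt (𝓡 d) (c i : M))) ≪
        Measure.pi fun _ : Fin n => (volume : Measure (EuclideanSpace ℝ (Fin d))) :=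
      pi_absolutelyContinuous fun i =>
        hμ.map_extChartAt _ (hNo _).measurableSet Set.inter_subset_left
    have h1 := hac.ae_le hrad
    rw [← Measure.pi_map_pi hae, ← Measure.restrict_pi_pi] at h1
    have h2 := ae_of_ae_map (by
      rw [Measure.restrict_pi_pi]
      exact aemeasurable_pi_lambda _ fun i =>
        (hae i).comp_quasiMeasurePreserving (Measure.quasiMeasurePreserving_eval _ i)) h1
    rw [ae_restrict_iff' (MeasurableSet.univ_pi fun i => (hNo _).measurableSet)] at h2
    filter_upwards [h2] with x hx hxN
    have hdiff := hx (fun i _ => hxN i) fun i _ => (hxN i).2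
    choose θ ψ hθ0 hθψ hθ hψ hθc hθd using exists_metric_chart (d := d) (M := M)
    refine sum_partialGradLength_sq_le hn (fun y => hF y x) (fun i => hθ0 (x i))
      (fun i => hθψ (x i)) (fun i => hθ (x i)) (fun i => hψ (x i)) ?_
    -- Rademacher gives differentiability in the fixed charts; the transition maps carry it to the
    -- metric charts centred at the `x i`.
    have h3 : DifferentiableAt ℝ (fun (v : Fin n → EuclideanSpace ℝ (Fin d)) i =>
        extChartAt (𝓡 d) (c i : M) (θ (x i) (v i))) 0 := by
      refine differentiableAt_pi.2 fun i => ?_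
      exact (hθd (x i) (c i) (hxN i).1).comp (0 : Fin n → EuclideanSpace ℝ (Fin d))
        (f := fun v => v i) (differentiableAt_apply i _)
    have h4 : DifferentiableAt ℝ Fc (fun i => extChartAt (𝓡 d) (c i : M)
        (θ (x i) ((0 : Fin n → EuclideanSpace ℝ (Fin d)) i))) := by
      simpa only [Pi.zero_apply, hθ0] using hdiff
    refine (h4.comp 0 h3).congr_of_eventuallyEq ?_
    have h5 : ∀ᶠ v : Fin n → EuclideanSpace ℝ (Fin d) in 𝓝 0,
        ∀ i, θ (x i) (v i) ∈ (extChartAt (𝓡 d) (c i : M)).source := by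
      refine eventually_all.2 fun i => ?_
      have h6 : Tendsto (fun v : Fin n → EuclideanSpace ℝ (Fin d) => v i) (𝓝 0) (𝓝 0) :=
        (continuous_apply i).tendsto 0
      have h7 := (hθc (x i)).tendsto.comp h6
      rw [hθ0] at h7
      exact h7.eventually ((isOpen_extChartAt_source (I := 𝓡 d) (c i : M)).mem_nhds (hxN i).1)
    filter_upwards [h5] with v hv
    simp only [hFc, Function.comp_apply]
    congr 1
    ext i
    exact ((extChartAt (𝓡 d) (c i : M)).left_inv (hv i)).symm
  filter_upwards [ae_all_iff.2 key] with x hx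
  have hc : ∀ i, ∃ c : s, x i ∈ N c := fun i => by
    have : x i ∈ ⋃ c ∈ s, N c := hs ▸ Set.mem_univ _
    simpa using this
  choose c hc using hc
  exact hx c hc

variable (d) in
theorem polishSpace_of_riemannian (M : Type*) [MetricSpace M] [SecondCountableTopology M]
    [ChartedSpace (EuclideanSpace ℝ (Fin d)) M] : PolishSpace M :=
  have := ChartedSpace.locallyCompactSpace (EuclideanSpace ℝ (Fin d)) M
  polishSpace_of_locallyCompactSpace M

theorem ManifoldAbsolutelyContinuous.gradientCondition {μ : Measure M} [IsProbabilityMeasure μ]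
    (hμ : ManifoldAbsolutelyContinuous d μ) (h2 : HasFiniteSecondMoment μ) :
    GradientCondition μ := fun n hn => by
  have := polishSpace_of_riemannian d M
  exact ae_sum_partialGradLength_sq_le hμ hn (fun x y => empiricalDist_sub_le h2 hn x y)
    (lipschitzWith_empiricalDist h2 hn)

end Charts

theorem ManifoldAbsolutelyContinuous.gradientCondition_and_talagrandT2 {d : ℕ} {M : Type*}
    [MetricSpace M] [SecondCountableTopology M] [ChartedSpace (EuclideanSpace ℝ (Fin d)) M]
    [IsManifold (𝓡 d) ∞ M] [Bundle.RiemannianBundle (fun x : M => TangentSpace (𝓡 d) x)]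
    [IsContMDiffRiemannianBundle (𝓡 d) ∞ (EuclideanSpace ℝ (Fin d))
      (fun x : M => TangentSpace (𝓡 d) x)]
    [IsRiemannianManifold (𝓡 d) M] [MeasurableSpace M] [BorelSpace M]
    {μ : Measure M} [IsProbabilityMeasure μ] (hμ : ManifoldAbsolutelyContinuous d μ) :
    (HasFiniteSecondMoment μ → GradientCondition μ) ∧
      ∀ C : ℝ, 0 < C → LogSobolev μ C → TalagrandT2 μ C := by
  -- Only continuity of the metric is used.
  have : IsContinuousRiemannianBundle (EuclideanSpace ℝ (Fin d))
      (fun x : M => TangentSpace (𝓡 d) x) := by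
    obtain ⟨g, hg, hgi⟩ := IsContMDiffRiemannianBundle.exists_contMDiff (IB := 𝓡 d) (n := ∞)
      (F := EuclideanSpace ℝ (Fin d)) (E := fun x : M => TangentSpace (𝓡 d) x)
    exact ⟨g, hg.continuous, hgi⟩
  have := polishSpace_of_riemannian d M
  exact ⟨hμ.gradientCondition, fun C hC h => talagrandT2_of_gradientCondition
    (hμ.gradientCondition (h.hasFiniteSecondMoment hC)) hC h⟩

/-- The atlas of the model space consists of the identity alone. -/
theorem manifoldAbsolutelyContinuous_of_absolutelyContinuous {d : ℕ}
    {μ : Measure (EuclideanSpace ℝ (Fin d))} (hμ : μ ≪ volume) :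
    ManifoldAbsolutelyContinuous d μ := fun s _ h => hμ (by
  have := h _ (chartedSpaceSelf_atlas.2 rfl)
  simpa using this)

end OttoVillani

theorem mainTheorem2 :
    -- metric spaces with a Polish topology
    (∀ (X : Type*) [MetricSpace X] [PolishSpace X] [MeasurableSpace X] [BorelSpace X]
      (μ : Measure X) [IsProbabilityMeasure μ],
      OttoVillani.GradientCondition μ →
      ∀ C : ℝ, 0 < C → OttoVillani.LogSobolev μ C → OttoVillani.TalagrandT2 μ C) ∧
    -- Euclidean spaces
    (∀ (d : ℕ) (μ : Measure (EuclideanSpace ℝ (Fin d))) [IsProbabilityMeasure μ],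
      μ ≪ volume →
      (OttoVillani.HasFiniteSecondMoment μ → OttoVillani.GradientCondition μ) ∧
      ∀ C : ℝ, 0 < C → OttoVillani.LogSobolev μ C → OttoVillani.TalagrandT2 μ C) ∧
    -- Riemannian manifolds with their Riemannian distance
    (∀ (d : ℕ) (M : Type*) [MetricSpace M] [SecondCountableTopology M]
      [ChartedSpace (EuclideanSpace ℝ (Fin d)) M] [IsManifold (𝓡 d) ∞ M]
      [Bundle.RiemannianBundle (fun x : M => TangentSpace (𝓡 d) x)]
      [IsContMDiffRiemannianBundle (𝓡 d) ∞ (EuclideanSpace ℝ (Fin d))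
        (fun x : M => TangentSpace (𝓡 d) x)]
      [IsRiemannianManifold (𝓡 d) M] [MeasurableSpace M] [BorelSpace M]
      (μ : Measure M) [IsProbabilityMeasure μ],
      OttoVillani.ManifoldAbsolutelyContinuous d μ →
      (OttoVillani.HasFiniteSecondMoment μ → OttoVillani.GradientCondition μ) ∧
      ∀ C : ℝ, 0 < C → OttoVillani.LogSobolev μ C → OttoVillani.TalagrandT2 μ C) := by
  refine ⟨fun X _ _ _ _ μ _ h C hC hL => OttoVillani.talagrandT2_of_gradientCondition h hC hL,
    fun d μ _ h => ?_, fun d M _ _ _ _ _ _ _ _ _ μ _ h => h.gradientCondition_and_talagrandT2⟩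
  exact (OttoVillani.manifoldAbsolutelyContinuous_of_absolutelyContinuous
    h).gradientCondition_and_talagrandT2
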